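/- Let $N\ge 1$ be an odd squarefree integer, $k\ge 1$ an odd integer, and $p$ an odd prime not dividing $N$. Let $f\in S_{2k}^{\mathrm{new}}(\Gamma_0(N))$ be a normalised newform, and write $a_\ell=a_\ell(f)$ for its $\ell$-th Fourier coefficient. Let $h=\sum_{n\ge1}c(n)q^n$ be a non-zero form in the new subspace $S_{k+1/2}^{\mathrm{new}}(N)$ of Kohnen's plus space of weight $k+\frac12$ and level $\Gamma_0(4N)$ (trivial character), in Shimura--Shintani correspondence with $f$: for every prime $\ell\nmid N$ the Hecke operator $T_{\ell^2}$ acts on $h$ as multiplication by $a_\ell$, that is, \[ c(\ell^2n)+\left(\tfrac{(-1)^kn}{\ell}\right)\ell^{k-1}c(n)+\ell^{2k-1}c(n/\ell^2)=a_\ell\,c(n) \] for all $n$ with $(-1)^kn\equiv0,1\pmod 4$, where $c(n/\ell^2)=0$ if $\ell^2\nmid n$. Let $F=\mathrm{SK}_N(h)$ be the Saito--Kurokawa lift of $h$, the function on the Siegel upper half-space $\mathcal H_2$ of genus two defined by \[ F(Z)=\sum_{B>0}A(B)\,e^{2\pi i\,\mathrm{Tr}(BZ)},\qquad A(B)=\sum_{0<d\mid\gcd(B),\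 (d,N)=1}d^k\,c\!\left(\frac{\det(2B)}{d^2}\right), \] where $B=\begin{pmatrix}n&r/2\\r/2&m\end{pmatrix}$ runs over the half-integral positive definite symmetric matrices ($n,r,m\in\mathbb Z$) and $\gcd(B)=\gcd(n,r,m)$. For functions $\Phi$ on $\mathcal H_2$ and $\psi$ on $\mathcal H\times\mathcal H$ put \[ (U\Phi)(Z)=p^{-3}\sum_{S\in\mathrm{Sym}_2(\mathbb Z/p\mathbb Z)}\Phi\!\left(\frac{Z+S}{p}\right),\qquad \varpi(\Phi)(\tau_1,\tau_2)=\Phi\begin{pmatrix}\tau_1&0\\0&\tau_2\end{pmatrix}, \] \[ (U\times U)\psi(\tau_1,\tau_2)=p^{-2}\sum_{b_1,b_2\bmod p}\psi\!\left(\frac{\tau_1+b_1}{p},\frac{\tau_2+b_2}{p}\right),\qquad (V\times V)\psi(\tau_1,\tau_2)=\psi(p\tau_1,p\tau_2), \] where $S$, $b_1$, $b_2$ run over integral representatives. (Thus $UF=\sum_BA(pB)q^B$.) Then the series defining $F$ is summable at every $Z\in\mathcal H_2$, and, as functions on $\mathcal H\times\mathcal H$, \[ (U\times U-p^{k-1})\,\varpi(UF)=(p^k-p^{k-1}+a_p)\,(U\times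 U)\varpi(F)-p^k(p^{k-1}+a_p)\,\varpi(F)+p^{3k-1}\,(V\times V)\varpi(F). \] -/

import Mathlib

open scoped MatrixGroups UpperHalfPlane Manifold

noncomputable section

namespace SaitoKurokawa

/-! ### Operators `U` and `V` in genus one -/

/-- The point `(τ + b) / m` of the upper half-plane. -/
def shiftDiv (m : ℕ) (hm : 0 < m) (b : ℤ) (τ : ℍ) : ℍ :=
  ⟨((τ : ℂ) + (b : ℂ)) / (m : ℂ), by
    have h : (((τ : ℂ) + (b : ℂ)) / (m : ℂ)).im = τ.im / (m : ℝ) := by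
      simp [Complex.div_natCast_im]
    rw [h]
    exact div_pos τ.im_pos (by exact_mod_cast hm)⟩

/-- The point `m τ` of the upper half-plane. -/
def scale (m : ℕ) (hm : 0 < m) (τ : ℍ) : ℍ :=
  ⟨(m : ℂ) * (τ : ℂ), by
    have h : ((m : ℂ) * (τ : ℂ)).im = (m : ℝ) * τ.im := by simp
    rw [h]
    exact mul_pos (by exact_mod_cast hm) τ.im_pos⟩

/-- `(U_m φ)(τ) = m⁻¹ ∑_{b mod m} φ((τ + b) / m)`, that is `∑ aₙ qⁿ ↦ ∑ a_{mn} qⁿ`. -/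
def opU (m : ℕ) (hm : 0 < m) (φ : ℍ → ℂ) (τ : ℍ) : ℂ :=
  (m : ℂ)⁻¹ * ∑ b ∈ Finset.range m, φ (shiftDiv m hm b τ)

/-- `(V_m φ)(τ) = φ(m τ)`, that is `∑ aₙ qⁿ ↦ ∑ aₙ q^{mn}`. -/
def opV (m : ℕ) (hm : 0 < m) (φ : ℍ → ℂ) (τ : ℍ) : ℂ :=
  φ (scale m hm τ)

/-- The `n`-th Fourier coefficient of a 1-periodic function on the upper half-plane,
with respect to `q = exp(2πiτ)`. -/
def qCoeff (φ : ℍ → ℂ) (n : ℕ) : ℂ :=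
  (UpperHalfPlane.qExpansion 1 φ).coeff n

/-- The normalised Petersson product of weight `w` for a subgroup `Γ` of finite index of `SL₂(ℤ)`:
`[SL₂(ℤ) : Γ]⁻¹ ∫_{Γ \ ℍ} f(τ) conj(g(τ)) y^(w - 2) dx dy`. The integral is computed over the
translates `γ⁻¹ 𝒟` of the standard fundamental domain `𝒟` of `SL₂(ℤ)`, where `γ` runs over
representatives of `SL₂(ℤ) / Γ`; the measure on `ℍ` is `dx dy / y²`. -/
def peterssonProduct (Γ : Subgroup SL(2, ℤ)) (w : ℝ) (f g : ℍ → ℂ) : ℂ :=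
  (Γ.index : ℂ)⁻¹ * ∑ᶠ q : SL(2, ℤ) ⧸ Γ, ∫ τ in ModularGroup.fd,
    (fun z : ℍ ↦ f z * (starRingEnd ℂ) (g z) * ((z.im ^ w : ℝ) : ℂ)) (q.out⁻¹ • τ)

/-! ### Integral weight -/

/-- `S_w(N)`: cusp forms of weight `w` for `Γ₀(N)` with trivial character. -/
abbrev CuspFormGamma0 (N : ℕ) (w : ℤ) : Type :=
  CuspForm ((CongruenceSubgroup.Gamma0 N).map (Matrix.SpecialLinearGroup.mapGL ℝ)) w

/-- The Hecke operator at a prime `ℓ` in weight `w` and level `N`: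
`T_ℓ = U_ℓ + ℓ^(w - 1) V_ℓ` if `ℓ ∤ N`, and `U_ℓ` if `ℓ ∣ N`. -/
def heckeT (N : ℕ) (w : ℤ) (l : ℕ) (hl : 0 < l) (φ : ℍ → ℂ) (τ : ℍ) : ℂ :=
  opU l hl φ τ + if l ∣ N then 0 else (l : ℂ) ^ (w - 1) * opV l hl φ τ

/-- `f` is a normalised newform of weight `w` and level `N`: it is orthogonal to all forms
`τ ↦ g(dτ)` coming from a level `M ≠ N` with `dM ∣ N`, its first coefficient is `1`, and it is an
eigenform of all Hecke operators. -/
structure IsNormalisedNewform (N : ℕ) (w : ℤ) (f : CuspFormGamma0 N w) : Prop where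
  new : ∀ (M d : ℕ) (hd : 0 < d), d * M ∣ N → M ≠ N → ∀ g : CuspFormGamma0 M w,
    peterssonProduct (CongruenceSubgroup.Gamma0 N) (w : ℝ) f (opV d hd g) = 0
  normalised : qCoeff f 1 = 1
  eigenform : ∀ (l : ℕ) (hl : l.Prime), ∃ c : ℂ, ∀ τ : ℍ, heckeT N w l hl.pos f τ = c * f τ

/-! ### Half-integral weight -/

/-- The theta function `θ(τ) = ∑_{n ∈ ℤ} q^(n²)`. -/
def theta (τ : ℍ) : ℂ :=
  jacobiTheta (2 * (τ : ℂ))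

/-- Cusp forms of weight `k + 1/2`, level `Γ₀(4M)` and trivial character in the sense of Shimura:
holomorphic functions with `h(γτ) = (θ(γτ) / θ(τ))^(2k+1) h(τ)` for `γ ∈ Γ₀(4M)` (`θ` has no zeros
on `ℍ`; the denominator is cleared) which vanish at every cusp, i.e.
`(cτ + d)^(-(k + 1/2)) h(γτ) → 0` as `Im τ → ∞` for all `γ ∈ SL₂(ℤ)` with lower row `(c, d)`. -/
structure IsHalfIntegralCuspForm (k M : ℕ) (h : ℍ → ℂ) : Prop where
  holo : MDiff h
  transform : ∀ γ ∈ CongruenceSubgroup.Gamma0 (4 * M), ∀ τ : ℍ,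
    h (γ • τ) * theta τ ^ (2 * k + 1) = theta (γ • τ) ^ (2 * k + 1) * h τ
  zero_at_cusps : ∀ γ : SL(2, ℤ), UpperHalfPlane.IsZeroAtImInfty fun τ : ℍ ↦
    ‖((γ 1 0 : ℤ) : ℂ) * (τ : ℂ) + ((γ 1 1 : ℤ) : ℂ)‖ ^ (-((k : ℝ) + 1 / 2)) * ‖h (γ • τ)‖

/-- `(-1)^k n` is congruent to `0` or `1` modulo `4`. -/
def IsPlusIndex (k n : ℕ) : Prop :=
  (-1 : ℤ) ^ k * (n : ℤ) ≡ 0 [ZMOD 4] ∨ (-1 : ℤ) ^ k * (n : ℤ) ≡ 1 [ZMOD 4]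

/-- Kohnen's plus space `S_{k+1/2}(M)`. -/
structure IsKohnenPlusForm (k M : ℕ) (h : ℍ → ℂ) : Prop where
  cuspForm : IsHalfIntegralCuspForm k M h
  plus : ∀ n : ℕ, ¬ IsPlusIndex k n → qCoeff h n = 0

/-- The new subspace `S_{k+1/2}^new(M)` of Kohnen's plus space (`M` odd and squarefree): the
orthogonal complement of `∑_{ℓ ∣ M} (S_{k+1/2}(M/ℓ) + U_{ℓ²} S_{k+1/2}(M/ℓ))`; here
`U_{ℓ²} = U_ℓ ∘ U_ℓ`. -/
structure IsKohnenNewform (k M : ℕ) (h : ℍ → ℂ) : Prop where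
  plusForm : IsKohnenPlusForm k M h
  new : ∀ (l : ℕ) (hl : l.Prime), l ∣ M → ∀ g : ℍ → ℂ, IsKohnenPlusForm k (M / l) g →
    peterssonProduct (CongruenceSubgroup.Gamma0 (4 * M)) ((k : ℝ) + 1 / 2) h g = 0 ∧
    peterssonProduct (CongruenceSubgroup.Gamma0 (4 * M)) ((k : ℝ) + 1 / 2) h
      (opU l hl.pos (opU l hl.pos g)) = 0

/-- The Kronecker symbol `(a / ℓ)` for a prime `ℓ`. -/
def kroneckerPrime (a : ℤ) (l : ℕ) : ℤ :=
  if l = 2 then ZMod.χ₈ (a : ZMod 8) else jacobiSym a l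

/-- The `n`-th coefficient of `T_{ℓ²} h`, where `h = ∑ c(n) qⁿ` is in the plus space:
`c(ℓ² n) + ((-1)^k n / ℓ) ℓ^(k-1) c(n) + ℓ^(2k-1) c(n / ℓ²)`, for `(-1)^k n ≡ 0, 1 (mod 4)`. -/
def heckeSqCoeff (k l : ℕ) (c : ℕ → ℂ) (n : ℕ) : ℂ :=
  c (l ^ 2 * n) + (kroneckerPrime ((-1) ^ k * (n : ℤ)) l : ℂ) * (l : ℂ) ^ (k - 1) * c n
    + (l : ℂ) ^ (2 * k - 1) * (if l ^ 2 ∣ n then c (n / l ^ 2) else 0)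

/-- `h` is in Shimura--Shintani correspondence with `f`: for all primes `ℓ ∤ N`,
the operator `T_{ℓ²}` acts on `h` as multiplication by `a_ℓ(f)`. -/
def InShimuraShintani (k N : ℕ) (f h : ℍ → ℂ) : Prop :=
  ∀ l : ℕ, l.Prime → ¬ l ∣ N → ∀ n : ℕ, IsPlusIndex k n →
    heckeSqCoeff k l (qCoeff h) n = qCoeff f l * qCoeff h n

/-! ### Genus two -/

/-- The Siegel upper half-space of genus two. -/
def SiegelUpperHalfSpace : Type :=
  {Z : Matrix (Fin 2) (Fin 2) ℂ // Z.IsSymm ∧ (Z.map Complex.im).PosDef}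

/-- The point `(Z + B) / m`, where `B` is the symmetric matrix with rows `(b₁, b₂)`, `(b₂, b₃)`. -/
def siegelShiftDiv (m : ℕ) (hm : 0 < m) (b₁ b₂ b₃ : ℤ) (Z : SiegelUpperHalfSpace) :
    SiegelUpperHalfSpace :=
  ⟨(m : ℂ)⁻¹ • (Z.1 + !![(b₁ : ℂ), (b₂ : ℂ); (b₂ : ℂ), (b₃ : ℂ)]), by
    refine ⟨?_, ?_⟩
    · ext i j
      have h := fun i j ↦ congrFun (congrFun Z.2.1 i) j
      simp only [Matrix.transpose_apply] at h
      fin_cases i <;> fin_cases j <;> simp [h, mul_add]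
    · have h : ((m : ℂ)⁻¹ • (Z.1 + !![(b₁ : ℂ), (b₂ : ℂ); (b₂ : ℂ), (b₃ : ℂ)])).map Complex.im
          = (m : ℝ)⁻¹ • Z.1.map Complex.im := by
        have e : (m : ℂ)⁻¹ = (((m : ℝ)⁻¹ : ℝ) : ℂ) := by push_cast; rfl
        ext i j
        rw [e]
        fin_cases i <;> fin_cases j <;> simp
      rw [h]
      exact Z.2.2.smul (by positivity)⟩

/-- The point `m Z`. -/
def siegelScale (m : ℕ) (hm : 0 < m) (Z : SiegelUpperHalfSpace) : SiegelUpperHalfSpace :=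
  ⟨(m : ℂ) • Z.1, by
    refine ⟨Z.2.1.smul _, ?_⟩
    have h : ((m : ℂ) • Z.1).map Complex.im = (m : ℝ) • Z.1.map Complex.im := by
      ext i j
      simp
    rw [h]
    exact Z.2.2.smul (by exact_mod_cast hm)⟩

/-- The diagonal point with entries `τ₁`, `τ₂`. -/
def siegelDiag (τ₁ τ₂ : ℍ) : SiegelUpperHalfSpace :=
  ⟨Matrix.diagonal ![(τ₁ : ℂ), (τ₂ : ℂ)], by
    refine ⟨Matrix.isSymm_diagonal _, ?_⟩
    have h : (Matrix.diagonal ![(τ₁ : ℂ), (τ₂ : ℂ)]).map Complex.im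
        = Matrix.diagonal ![τ₁.im, τ₂.im] := by
      ext i j
      fin_cases i <;> fin_cases j <;> simp
    rw [h]
    refine Matrix.PosDef.diagonal fun i ↦ ?_
    fin_cases i
    · exact τ₁.im_pos
    · exact τ₂.im_pos⟩

/-- `(U_m Φ)(Z) = m⁻³ ∑_B Φ((Z + B) / m)`, with `B` over the symmetric integral matrices modulo
`m`; on `q`-expansions this is `∑ A(B) q^B ↦ ∑ A(mB) q^B`. -/
def siegelU (m : ℕ) (hm : 0 < m) (Φ : SiegelUpperHalfSpace → ℂ) (Z : SiegelUpperHalfSpace) : ℂ :=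
  ((m : ℂ) ^ 3)⁻¹ * ∑ b₁ ∈ Finset.range m, ∑ b₂ ∈ Finset.range m, ∑ b₃ ∈ Finset.range m,
    Φ (siegelShiftDiv m hm b₁ b₂ b₃ Z)

/-- Half-integral positive definite matrices `B` with rows `(n, r/2)`, `(r/2, m)`, recorded by the
triple `(n, r, m)` of integers. -/
abbrev HalfIntegralPosDef : Type :=
  {b : ℤ × ℤ × ℤ // 0 < b.1 ∧ 0 < 4 * b.1 * b.2.2 - b.2.1 ^ 2}

/-- The matrix with rows `(n, r/2)`, `(r/2, m)`. -/
def HalfIntegralPosDef.toMatrix (B : HalfIntegralPosDef) : Matrix (Fin 2) (Fin 2) ℂ :=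
  !![(B.1.1 : ℂ), (B.1.2.1 : ℂ) / 2; (B.1.2.1 : ℂ) / 2, (B.1.2.2 : ℂ)]

/-- `det(2B) = 4nm - r²`, a positive integer. -/
def HalfIntegralPosDef.disc (B : HalfIntegralPosDef) : ℕ :=
  (4 * B.1.1 * B.1.2.2 - B.1.2.1 ^ 2).toNat

/-- `gcd(n, r, m)`. -/
def HalfIntegralPosDef.content (B : HalfIntegralPosDef) : ℕ :=
  Nat.gcd B.1.1.natAbs (Nat.gcd B.1.2.1.natAbs B.1.2.2.natAbs)

/-- `q^B = exp(2πi Tr(BZ))`. -/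
def qMonomial (B : HalfIntegralPosDef) (Z : SiegelUpperHalfSpace) : ℂ :=
  Complex.exp (2 * Real.pi * Complex.I * (B.toMatrix * Z.1).trace)

/-- `A(B) = ∑_{d ∣ gcd(B), (d, N) = 1} d^k c(det(2B) / d²)`. -/
def skCoeff (k N : ℕ) (c : ℕ → ℂ) (B : HalfIntegralPosDef) : ℂ :=
  ∑ d ∈ B.content.divisors with d.Coprime N, (d : ℂ) ^ k * c (B.disc / d ^ 2)

/-- The Saito--Kurokawa lift `SK_N(h) = ∑_{B > 0} A(B) q^B`. -/
def skLift (k N : ℕ) (h : ℍ → ℂ) (Z : SiegelUpperHalfSpace) : ℂ :=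
  ∑' B : HalfIntegralPosDef, skCoeff k N (qCoeff h) B * qMonomial B Z

/-! ### Pullback to the diagonal -/

/-- The pullback `ϖ(Φ)`, i.e. the restriction of `Φ` to `ℍ × ℍ`. -/
def pullback (Φ : SiegelUpperHalfSpace → ℂ) (τ : ℍ × ℍ) : ℂ :=
  Φ (siegelDiag τ.1 τ.2)

/-- The operator `U × U`: apply `U_m` in each of the two variables. -/
def opUU (m : ℕ) (hm : 0 < m) (φ : ℍ × ℍ → ℂ) (τ : ℍ × ℍ) : ℂ :=
  opU m hm (fun τ₁ ↦ opU m hm (fun τ₂ ↦ φ (τ₁, τ₂)) τ.2) τ.1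

/-- The operator `V × V`: apply `V_m` in each of the two variables. -/
def opVV (m : ℕ) (hm : 0 < m) (φ : ℍ × ℍ → ℂ) (τ : ℍ × ℍ) : ℂ :=
  opV m hm (fun τ₁ ↦ opV m hm (fun τ₂ ↦ φ (τ₁, τ₂)) τ.2) τ.1

end SaitoKurokawa

end

open SaitoKurokawa

open SaitoKurokawa

/-! The identity is a statement about the coefficients A(n, r, m), with r kept as an index even
though q₁ⁿq₂ᵐ does not see it. Write b = (n, r, m), D = 4nm - r², a = a_p and λ = p^k - p^(k-1) + a.

After moving a term, the left side has coefficients A(p·b') - λA(b') with b' = (pn, r, pm). If p ∤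
r, then -D(b') ≡ r² mod p is a nonzero square. The Hecke relation at p then reads c(p²D) = (a -
p^(k-1))c(D), which makes the difference vanish (`skCoeffExt_smul_of_not_dvd`). So only r = pr'
survives and b' = pb. There the Hecke relation at p²D, where the quadratic symbol is 0, gives a
recursion among A(p²b), A(pb), A(b), A(b/p) (`skCoeffExt_recursion`). This is the right side.

All rearrangements need absolute convergence. It follows from polynomial growth of c(n), which holds
since |h|y^(weight/2) is invariant under Γ₀(4N), by comparison with θ (`norm_theta_smul`), and grows
at most polynomially at the cusps. -/

namespace SaitoKurokawa
open ModularGroup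
open scoped Asymptotics

/-! ### The theta function under Γ₀(4) -/

/-- A subgroup of `SL₂(ℤ)` containing `-1`, `T` and `S T⁻⁴ S⁻¹` contains `Γ₀(4)`. -/
theorem gamma0_four_le {H : Subgroup SL(2, ℤ)} (hneg : -1 ∈ H) (hT : T ∈ H)
    (hW : S * T ^ (-4 : ℤ) * S⁻¹ ∈ H) : CongruenceSubgroup.Gamma0 4 ≤ H := by
  have hWn (n : ℤ) : S * T ^ (-4 * n) * S⁻¹ ∈ H := by
    rw [zpow_mul, ← conj_zpow]; exact zpow_mem hW n
  -- Euclidean descent on the lower left entry: right multiplication by Tⁿ and by the conjugate of a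
  -- power of T⁴ shifts the two bottom entries by multiples of each other.
  have key : ∀ (m : ℕ) (γ : SL(2, ℤ)), (4 : ℤ) ∣ γ 1 0 → (γ 1 0).natAbs = m → γ ∈ H := by
    intro m
    induction m using Nat.strong_induction_on with
    | _ m ih =>
    intro γ h4 hm
    have hdet := γ.det_coe
    rw [Matrix.det_fin_two] at hdet
    by_cases hc : γ 1 0 = 0
    · rw [hc, mul_zero, sub_zero] at hdet
      rcases Int.mul_eq_one_iff_eq_one_or_neg_one.1 hdet with ⟨ha, hd⟩ | ⟨ha, hd⟩
      · have : γ = T ^ (γ 0 1) := by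
          ext i j
          rw [coe_T_zpow]
          fin_cases i <;> fin_cases j <;> simp [ha, hd, hc]
        rw [this]; exact zpow_mem hT _
      · have : γ = -1 * T ^ (-γ 0 1) := by
          ext i j
          rw [neg_mul, one_mul, Matrix.SpecialLinearGroup.coe_neg, coe_T_zpow]
          fin_cases i <;> fin_cases j <;> simp [ha, hd, hc]
        rw [this]; exact mul_mem hneg (zpow_mem hT _)
    · obtain ⟨c, hc4⟩ := h4
      set d := γ 1 1 with hd
      have hdodd : ¬ (2 : ℤ) ∣ d := by
        rintro ⟨e, he⟩
        rw [hc4, he] at hdet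
        have : 2 * (γ 0 0 * e - γ 0 1 * (2 * c)) = 1 := by linarith
        omega
      -- first make the lower right entry small, then the lower left one
      set n := - round ((d : ℚ) / (4 * c : ℤ)) with hn
      have hcQ : ((4 * c : ℤ) : ℚ) ≠ 0 := by rw [← hc4]; exact_mod_cast hc
      have h1 : |((d + n * (4 * c) : ℤ) : ℚ)| ≤ |((4 * c : ℤ) : ℚ)| / 2 := by
        have := abs_sub_round ((d : ℚ) / (4 * c : ℤ))
        have e : ((d + n * (4 * c) : ℤ) : ℚ)
            = ((d : ℚ) / (4 * c : ℤ) - round ((d : ℚ) / (4 * c : ℤ))) * ((4 * c : ℤ) : ℚ) := by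
          rw [sub_mul, div_mul_cancel₀ _ hcQ, hn]; push_cast; ring
        rw [e, abs_mul]
        nlinarith [abs_nonneg ((4 * c : ℤ) : ℚ)]
      set d' := d + n * (4 * c) with hd'
      have h1' : 2 * |d'| ≤ |4 * c| := by
        have : 2 * |(d' : ℚ)| ≤ |((4 * c : ℤ) : ℚ)| := by linarith
        exact_mod_cast this
      have hd'odd : ¬ (2 : ℤ) ∣ d' := by
        exact fun h ↦ hdodd ((dvd_add_left ⟨n * (2 * c), by ring⟩).1 h)
      -- Equality would make d' = ±2c even. Strictness matters: it is what makes the descent step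
      -- lower |4c|.
      have h1'' : 2 * |d'| < |4 * c| := by
        refine lt_of_le_of_ne h1' fun h ↦ hd'odd ((dvd_abs 2 d').1 ⟨|c|, ?_⟩)
        rw [abs_mul 4 c] at h
        norm_num at h
        linarith
      have hd'0 : d' ≠ 0 := by rintro h; rw [h] at hd'odd; simp at hd'odd
      have hdQ : ((4 * d' : ℤ) : ℚ) ≠ 0 := by
        exact_mod_cast mul_ne_zero (by norm_num) hd'0
      set l := - round (((4 * c : ℤ) : ℚ) / (4 * d' : ℤ)) with hl
      have h2 : |((4 * c + l * (4 * d') : ℤ) : ℚ)| ≤ |((4 * d' : ℤ) : ℚ)| / 2 := by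
        have := abs_sub_round (((4 * c : ℤ) : ℚ) / (4 * d' : ℤ))
        have e : ((4 * c + l * (4 * d') : ℤ) : ℚ)
            = (((4 * c : ℤ) : ℚ) / (4 * d' : ℤ) - round (((4 * c : ℤ) : ℚ) / (4 * d' : ℤ)))
              * ((4 * d' : ℤ) : ℚ) := by
          rw [sub_mul, div_mul_cancel₀ _ hdQ, hl]; push_cast; ring
        rw [e, abs_mul]
        nlinarith [abs_nonneg ((4 * d' : ℤ) : ℚ)]
      have h2' : 2 * |4 * c + l * (4 * d')| ≤ |4 * d'| := by
        have : 2 * |((4 * c + l * (4 * d') : ℤ) : ℚ)| ≤ |((4 * d' : ℤ) : ℚ)| := by linarith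
        exact_mod_cast this
      have h3 : |4 * c + l * (4 * d')| < |4 * c| := by
        rw [abs_mul 4 d'] at h2'
        norm_num at h2'
        linarith
      have e10 : (γ * T ^ n * (S * T ^ (-4 * l) * S⁻¹)) 1 0 = 4 * c + l * (4 * d') := by
        simp only [Matrix.SpecialLinearGroup.coe_mul, coe_T_zpow, Matrix.SpecialLinearGroup.coe_inv,
          Matrix.mul_apply, Fin.sum_univ_two, coe_S, Matrix.adjugate_fin_two]
        simp [hc4, ← hd, hd']
        ring
      have hmem : γ * T ^ n * (S * T ^ (-4 * l) * S⁻¹) ∈ H := by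
        refine ih (4 * c + l * (4 * d')).natAbs ?_ _ ?_ (by rw [e10])
        · rw [← hm, hc4]; zify; exact h3
        · rw [e10]; exact ⟨c + l * d', by ring⟩
      rwa [H.mul_mem_cancel_right (hWn l), H.mul_mem_cancel_right (zpow_mem hT n)] at hmem
  intro γ hγ
  rw [CongruenceSubgroup.Gamma0_mem] at hγ
  exact key _ γ ((ZMod.intCast_zmod_eq_zero_iff_dvd _ 4).1 hγ) rfl

/-- Taking norms in the weight 1/2 inversion formula removes the branch of the square root; the
fourth power clears the fractional exponents. -/
theorem norm_jacobiTheta_neg_inv {z : ℂ} (hz : 0 < z.im) :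
    ‖jacobiTheta (-1 / z)‖ ^ 4 * (-1 / z).im = ‖jacobiTheta z‖ ^ 4 * z.im := by
  have h0 : z ≠ 0 := by rintro rfl; simp at hz
  have h := jacobiTheta_S_smul ⟨z, hz⟩
  have e : ((S • (⟨z, hz⟩ : ℍ) : ℍ) : ℂ) = -1 / z := by
    rw [UpperHalfPlane.modular_S_smul]
    change (-z)⁻¹ = _
    rw [inv_neg, neg_div, one_div]
  rw [e] at h
  change _ = (-Complex.I * z) ^ (1 / 2 : ℂ) * jacobiTheta z at h
  have h4 : ‖(-Complex.I * z) ^ (1 / 2 : ℂ)‖ ^ 2 = ‖z‖ := by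
    rw [← norm_pow, one_div, Complex.cpow_ofNat_inv_pow]; simp
  have him : (-1 / z).im = z.im / ‖z‖ ^ 2 := by
    rw [Complex.sq_norm, neg_div, one_div, Complex.neg_im, Complex.inv_im]; ring
  rw [h, norm_mul, mul_pow, him, show ‖(-Complex.I * z) ^ (1 / 2 : ℂ)‖ ^ 4 = ‖z‖ ^ 2 by
    rw [← h4]; ring]
  have : ‖z‖ ≠ 0 := norm_ne_zero_iff.2 h0
  field_simp

/-- The elements with this invariance form a subgroup, so generators of Γ₀(4) suffice and the theta
multiplier is never computed. -/
theorem norm_theta_smul {γ : SL(2, ℤ)} (hγ : γ ∈ CongruenceSubgroup.Gamma0 4) (τ : ℍ) :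
    ‖theta (γ • τ)‖ ^ 4 * (γ • τ).im = ‖theta τ‖ ^ 4 * τ.im := by
  let H : Subgroup SL(2, ℤ) :=
    { carrier := {γ | ∀ τ : ℍ, ‖theta (γ • τ)‖ ^ 4 * (γ • τ).im = ‖theta τ‖ ^ 4 * τ.im}
      one_mem' := fun τ ↦ by rw [one_smul]
      mul_mem' := fun {a b} ha hb τ ↦ by rw [mul_smul, ha, hb]
      inv_mem' := fun {a} ha τ ↦ by rw [← ha (a⁻¹ • τ), smul_inv_smul] }
  have hneg : (-1 : SL(2, ℤ)) ∈ H := fun τ ↦ by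
    rw [ModularGroup.SL_neg_smul, one_smul]
  have hT : T ∈ H := fun τ ↦ by
    have : (T • τ : ℍ) = (1 : ℝ) +ᵥ τ := UpperHalfPlane.modular_T_smul τ
    rw [this, theta, UpperHalfPlane.coe_vadd, UpperHalfPlane.vadd_im, Complex.ofReal_one, mul_add,
      mul_one, jacobiTheta_two_add, theta]
  have hW : S * T ^ (-4 : ℤ) * S⁻¹ ∈ H := fun τ ↦ by
    set w := (S * T ^ (-4 : ℤ) * S⁻¹) • τ with hw
    have hτ : (τ : ℂ) ≠ 0 := τ.ne_zero
    have e : (w : ℂ) = τ / (4 * τ + 1) := by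
      have hm : ((S * T ^ (-4 : ℤ) * S⁻¹ : SL(2, ℤ)) : Matrix (Fin 2) (Fin 2) ℤ)
          = !![1, 0; 4, 1] := by
        simp only [Matrix.SpecialLinearGroup.coe_mul, coe_T_zpow, Matrix.SpecialLinearGroup.coe_inv,
          coe_S, Matrix.adjugate_fin_two]
        decide
      rw [hw, UpperHalfPlane.coe_specialLinearGroup_apply, hm]
      simp
    have h2 : 0 < (2 * (τ : ℂ)).im := by simp [τ.im_pos]
    have him : (-1 / (2 * (τ : ℂ))).im > 0 := by
      rw [neg_div, one_div, Complex.neg_im, Complex.inv_im, neg_div, neg_neg]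
      exact div_pos h2 (Complex.normSq_pos.2 (by simpa using hτ))
    have h41 : (4 * (τ : ℂ) + 1) ≠ 0 := by
      intro h
      have := congrArg Complex.im h
      simp [τ.im_ne_zero] at this
    -- In the variable 2τ the map τ ↦ τ/(4τ+1) is a translation by -2 conjugated by the inversion,
    -- and 2 is a period of `jacobiTheta`.
    have e2 : (2 * (w : ℂ)) = -1 / (-1 / (2 * (τ : ℂ)) - 2) := by
      have h0 : (-1 / (2 * (τ : ℂ)) - 2) = -(4 * τ + 1) / (2 * τ) := by
        field_simp; ring
      rw [e, h0]; field_simp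
    have e3 : jacobiTheta (-1 / (2 * (τ : ℂ)) - 2) = jacobiTheta (-1 / (2 * (τ : ℂ))) := by
      rw [← jacobiTheta_two_add]; congr 1; ring
    have k1 := norm_jacobiTheta_neg_inv (z := -1 / (2 * (τ : ℂ)) - 2) (by simpa using him)
    have k2 := norm_jacobiTheta_neg_inv h2
    rw [← e2, e3, show (-1 / (2 * (τ : ℂ)) - 2).im = (-1 / (2 * (τ : ℂ))).im by simp, k2] at k1
    have i1 : (2 * (w : ℂ)).im = 2 * w.im := by simp
    have i2 : (2 * (τ : ℂ)).im = 2 * τ.im := by simp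
    rw [i1, i2] at k1
    rw [theta, theta]
    linarith
  exact gamma0_four_le (H := H) hneg hT hW hγ τ

/-- By the identity theorem, vanishing near one point would force vanishing at i. But |ϑ(i) - 1| ≤
2x/(1 - x) < 1 with x = e^(-π) < 1/4. -/
theorem jacobiTheta_frequently_ne_zero {z₀ : ℂ} (hz₀ : 0 < z₀.im) :
    ∃ᶠ z in nhds z₀, jacobiTheta z ≠ 0 := by
  intro h
  simp only [not_not] at h
  have hd : DifferentiableOn ℂ jacobiTheta {z | 0 < z.im} := fun z hz ↦
    (differentiableAt_jacobiTheta hz).differentiableWithinAt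
  have ho : IsOpen {z : ℂ | 0 < z.im} := isOpen_lt continuous_const Complex.continuous_im
  have h0 := (hd.analyticOnNhd ho).eqOn_zero_of_preconnected_of_eventuallyEq_zero
    (convex_halfSpace_im_gt 0).isPreconnected hz₀ h
  have h1 := norm_jacobiTheta_sub_one_le (τ := Complex.I) (by simp)
  rw [h0 (show Complex.I ∈ {z : ℂ | 0 < z.im} by simp)] at h1
  have h2 : Real.exp (-Real.pi) < 1 / 4 := by
    rw [Real.exp_neg, inv_eq_one_div]
    apply one_div_lt_one_div_of_lt (by norm_num)
    linarith [Real.add_one_le_exp Real.pi, Real.pi_gt_three, Real.add_one_lt_exp Real.pi_ne_zero]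
  simp only [Pi.zero_apply, zero_sub, norm_neg, norm_one, Complex.I_im, mul_one] at h1
  rw [div_mul_eq_mul_div, le_div_iff₀ (by linarith)] at h1
  linarith

/-- Density, with continuity, is enough to divide the automorphy relation by powers of θ; that θ has
no zeros at all is not needed. -/
theorem dense_theta_ne_zero : Dense {τ : ℍ | theta τ ≠ 0} := by
  intro τ
  rw [mem_closure_iff_frequently]
  intro h
  refine jacobiTheta_frequently_ne_zero (z₀ := 2 * (τ : ℂ)) (by simp [τ.im_pos]) ?_
  have hc : Filter.Tendsto (fun z : ℂ ↦ UpperHalfPlane.ofComplex (z / 2)) (nhds (2 * (τ : ℂ)))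
      (nhds τ) := by
    have h1 : Filter.Tendsto (fun z : ℂ ↦ z / 2) (nhds (2 * (τ : ℂ))) (nhds (τ : ℂ)) := by
      have : Continuous fun z : ℂ ↦ z / 2 := by fun_prop
      simpa using this.tendsto (2 * (τ : ℂ))
    have h2 := (UpperHalfPlane.contMDiffAt_ofComplex (n := 1) τ.im_pos).continuousAt.tendsto
    rw [UpperHalfPlane.ofComplex_apply] at h2
    exact h2.comp h1
  have ho : ∀ᶠ z : ℂ in nhds (2 * (τ : ℂ)), 0 < z.im :=
    (isOpen_lt continuous_const Complex.continuous_im).mem_nhds (by simp [τ.im_pos])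
  filter_upwards [hc.eventually h, ho] with z hz hz0
  have : (UpperHalfPlane.ofComplex (z / 2) : ℂ) = z / 2 := by
    rw [UpperHalfPlane.ofComplex_apply_of_im_pos (by simpa using hz0)]
  simp only [not_not, theta, this] at hz
  rw [← hz, mul_div_cancel₀ z two_ne_zero]
  simp

/-! ### Growth of half-integral weight cusp forms and of their coefficients -/

variable {k M : ℕ} {h : ℍ → ℂ}

theorem IsHalfIntegralCuspForm.continuous (hh : IsHalfIntegralCuspForm k M h) : Continuous h :=
  hh.holo.continuous

theorem IsHalfIntegralCuspForm.norm_smul (hh : IsHalfIntegralCuspForm k M h) {γ : SL(2, ℤ)}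
    (hγ : γ ∈ CongruenceSubgroup.Gamma0 (4 * M)) (τ : ℍ) :
    ‖h (γ • τ)‖ * (γ • τ).im ^ (((k : ℝ) + 1 / 2) / 2)
      = ‖h τ‖ * τ.im ^ (((k : ℝ) + 1 / 2) / 2) := by
  have hγ4 : γ ∈ CongruenceSubgroup.Gamma0 4 := by
    rw [CongruenceSubgroup.Gamma0_mem, ZMod.intCast_zmod_eq_zero_iff_dvd] at hγ ⊢
    exact (by push_cast; exact dvd_mul_right _ _ : ((4 : ℕ) : ℤ) ∣ ((4 * M : ℕ) : ℤ)).trans hγ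
  have hsmul : Continuous fun τ : ℍ ↦ γ • τ := by
    simp only [sl_moeb]
    fun_prop
  have hcont {φ : ℍ → ℍ} (hφ : Continuous φ) :
      Continuous fun τ ↦ ‖h (φ τ)‖ * (φ τ).im ^ (((k : ℝ) + 1 / 2) / 2) :=
    (hh.continuous.comp hφ).norm.mul
      ((UpperHalfPlane.continuous_im.comp hφ).rpow_const fun τ ↦ .inl (φ τ).im_ne_zero)
  refine congrFun ((hcont hsmul).ext_on dense_theta_ne_zero (hcont continuous_id) ?_) τ
  intro τ hτ
  have h1 := congrArg norm (hh.transform γ hγ τ)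
  rw [norm_mul, norm_mul, norm_pow, norm_pow] at h1
  have h2 := norm_theta_smul hγ4 τ
  have hy := τ.im_pos
  have hy' := (γ • τ).im_pos
  -- Raising |θ|⁴y to the power (2k+1)/4 turns the invariance for θ into the one for |θ|^(2k+1)
  -- times half the weight in y.
  have h3 {x y : ℝ} (hx : 0 ≤ x) (hy : 0 ≤ y) :
      (x ^ 4 * y) ^ ((2 * k + 1) / 4 : ℝ) = x ^ (2 * k + 1) * y ^ (((k : ℝ) + 1 / 2) / 2) := by
    rw [Real.mul_rpow (by positivity) hy, ← Real.rpow_natCast x 4, ← Real.rpow_mul hx,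
      ← Real.rpow_natCast x (2 * k + 1)]
    congr 2 <;> push_cast <;> ring
  have h4 := congrArg (fun x : ℝ ↦ x ^ ((2 * k + 1) / 4 : ℝ)) h2
  simp only [h3 (norm_nonneg _) hy.le, h3 (norm_nonneg _) hy'.le] at h4
  have h5 : ‖theta τ‖ ^ (2 * k + 1) ≠ 0 := pow_ne_zero _ (norm_ne_zero_iff.2 hτ)
  apply mul_right_cancel₀ h5
  dsimp only [id]
  linear_combination (γ • τ).im ^ (((k : ℝ) + 1 / 2) / 2) * h1 + ‖h τ‖ * h4

theorem IsHalfIntegralCuspForm.exists_norm_le (hM : M ≠ 0) (hh : IsHalfIntegralCuspForm k M h) :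
    ∃ C, ∀ τ : ℍ, τ.im ≤ 1 → ‖h τ‖ ≤ C * (1 / τ.im) ^ (k + 1) := by
  have : NeZero (4 * M) := ⟨by omega⟩
  set s : ℝ := ((k : ℝ) + 1 / 2) / 2 with hs
  have hs0 : 0 ≤ s := by positivity
  have hO (γ : SL(2, ℤ)) : (fun τ : ℍ ↦ ‖h (γ • τ)‖ * (γ • τ).im ^ s)
      =O[UpperHalfPlane.atImInfty] fun τ ↦ τ.im ^ s := by
    have h0 := (hh.zero_at_cusps γ).isBoundedAtImInfty
    have : (fun τ : ℍ ↦ ‖h (γ • τ)‖ * (γ • τ).im ^ s) = fun τ : ℍ ↦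
        (‖((γ 1 0 : ℤ) : ℂ) * (τ : ℂ) + ((γ 1 1 : ℤ) : ℂ)‖ ^ (-((k : ℝ) + 1 / 2)) * ‖h (γ • τ)‖)
          * τ.im ^ s := by
      funext τ
      have hd := UpperHalfPlane.denom_ne_zero γ τ
      rw [denom_apply] at hd
      have hd' := norm_pos_iff.2 hd
      rw [im_smul_eq_div_normSq, denom_apply, Real.div_rpow τ.im_pos.le (Complex.normSq_nonneg _),
        Complex.normSq_eq_norm_sq, ← Real.rpow_natCast, ← Real.rpow_mul hd'.le,
        Real.rpow_neg hd'.le, show ((2 : ℕ) : ℝ) * s = (k : ℝ) + 1 / 2 by rw [hs]; push_cast; ring]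
      ring
    rw [this]
    have h1 := Asymptotics.IsBigO.mul h0 (Asymptotics.isBigO_refl (fun τ : ℍ ↦ τ.im ^ s)
      UpperHalfPlane.atImInfty)
    simpa using h1
  -- This yields |h|yˢ ≤ C max(y, 1/y)ˢ. For y ≤ 1 it means |h| ≤ C y^(-(k+1/2)), rounded up below
  -- to the integer exponent k+1.
  obtain ⟨C, hC⟩ := exists_bound_of_subgroup_invariant_of_isBigO
    (f := fun τ : ℍ ↦ ‖h τ‖ * τ.im ^ s) (t := s)
    (hh.continuous.norm.mul (UpperHalfPlane.continuous_im.rpow_const fun τ ↦ .inl τ.im_ne_zero))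
    hs0 hO (Γ := CongruenceSubgroup.Gamma0 (4 * M)) fun γ hγ τ ↦ hh.norm_smul hγ τ
  refine ⟨C, fun τ hτ ↦ ?_⟩
  have hy := τ.im_pos
  have h1 := hC τ
  have hmax : max τ.im (1 / τ.im) = 1 / τ.im :=
    max_eq_right (hτ.trans (by rwa [le_div_iff₀ hy, one_mul]))
  rw [hmax, Real.norm_of_nonneg (by positivity), ← le_div_iff₀ (by positivity)] at h1
  have hC0 : 0 ≤ C := by
    by_contra hlt
    have : C * (1 / τ.im) ^ s / τ.im ^ s < 0 :=
      div_neg_of_neg_of_pos (mul_neg_of_neg_of_pos (not_le.1 hlt) (by positivity)) (by positivity)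
    linarith [norm_nonneg (h τ)]
  refine h1.trans ?_
  rw [mul_div_assoc, div_eq_mul_inv _ (τ.im ^ s), ← Real.inv_rpow hy.le, ← one_div,
    ← Real.rpow_add (by positivity), ← Real.rpow_natCast]
  refine mul_le_mul_of_nonneg_left (Real.rpow_le_rpow_of_exponent_le ?_ ?_) hC0
  · rw [le_div_iff₀ hy]; linarith
  · push_cast; rw [hs]; linarith

theorem theta_vadd_one (τ : ℍ) : theta ((1 : ℝ) +ᵥ τ) = theta τ := by
  rw [theta, UpperHalfPlane.coe_vadd, Complex.ofReal_one, mul_add, mul_one, jacobiTheta_two_add,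
    theta]

theorem IsHalfIntegralCuspForm.vadd_one (hh : IsHalfIntegralCuspForm k M h) (τ : ℍ) :
    h ((1 : ℝ) +ᵥ τ) = h τ := by
  have hc : Continuous fun τ : ℍ ↦ (1 : ℝ) +ᵥ τ := by
    rw [UpperHalfPlane.isEmbedding_coe.continuous_iff]
    simp only [Function.comp_def, UpperHalfPlane.coe_vadd]
    fun_prop
  refine congrFun ((hh.continuous.comp hc).ext_on dense_theta_ne_zero hh.continuous ?_) τ
  intro τ hτ
  have h1 := hh.transform T (by simp [CongruenceSubgroup.Gamma0_mem, coe_T]) τ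
  rw [UpperHalfPlane.modular_T_smul, theta_vadd_one, mul_comm] at h1
  exact mul_left_cancel₀ (pow_ne_zero _ hτ) h1

theorem IsHalfIntegralCuspForm.isBoundedAtImInfty (hh : IsHalfIntegralCuspForm k M h) :
    UpperHalfPlane.IsBoundedAtImInfty h := by
  have := (hh.zero_at_cusps 1).isBoundedAtImInfty
  simpa [UpperHalfPlane.isBoundedAtImInfty_iff] using this

theorem IsHalfIntegralCuspForm.periodic (hh : IsHalfIntegralCuspForm k M h) :
    Function.Periodic (h ∘ UpperHalfPlane.ofComplex) ((1 : ℝ) : ℂ) := by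
  intro w
  rw [Complex.ofReal_one]
  by_cases! hw : 0 < w.im
  · have : 0 < (w + 1).im := by simp [hw]
    simp only [Function.comp_apply, UpperHalfPlane.ofComplex_apply_of_im_pos this,
      UpperHalfPlane.ofComplex_apply_of_im_pos hw]
    refine Eq.trans ?_ (hh.vadd_one ⟨w, hw⟩)
    congr 1
    ext
    simp [add_comm]
  · have : (w + 1).im ≤ 0 := by simpa using hw
    simp [UpperHalfPlane.ofComplex_apply_of_im_nonpos this,
      UpperHalfPlane.ofComplex_apply_of_im_nonpos hw]

/-- Hecke's argument: integrate at height t = 1/(n+1), where e^(2πnt) ≤ e^(2π). The shift by 1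
covers n = 0 and keeps t ≤ 1. -/
theorem IsHalfIntegralCuspForm.exists_norm_qCoeff_le (hM : M ≠ 0)
    (hh : IsHalfIntegralCuspForm k M h) :
    ∃ C, 0 ≤ C ∧ ∀ n : ℕ, ‖qCoeff h n‖ ≤ C * ((n : ℝ) + 1) ^ (k + 1) := by
  obtain ⟨C, hC⟩ := hh.exists_norm_le hM
  have hC0 : 0 ≤ C := by
    have := hC UpperHalfPlane.I (by simp)
    simp at this
    exact (norm_nonneg _).trans this
  refine ⟨Real.exp (2 * Real.pi) * C, by positivity, fun n ↦ ?_⟩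
  obtain ⟨t, ht, hnt⟩ : ∃ t : ℝ, 0 < t ∧ 1 / t = (n : ℝ) + 1 :=
    ⟨1 / ((n : ℝ) + 1), by positivity, by simp⟩
  have ht1 : t * ((n : ℝ) + 1) = 1 := by rw [← hnt]; field_simp
  rw [qCoeff, UpperHalfPlane.qExpansion_coeff_eq_intervalIntegral one_pos hh.periodic hh.holo
    hh.isBoundedAtImInfty n ht]
  simp only [Complex.ofReal_one, div_one, one_mul]
  refine (intervalIntegral.norm_integral_le_of_norm_le_const
    (C := Real.exp (2 * Real.pi) * C * ((n : ℝ) + 1) ^ (k + 1)) fun u _ ↦ ?_).trans (by simp)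
  rw [norm_mul, norm_div, norm_one, norm_pow, Function.Periodic.norm_qParam]
  have him : UpperHalfPlane.im ⟨(u : ℂ) + t * Complex.I, by simpa using ht⟩ = t := by
    simp [← UpperHalfPlane.coe_im]
  have h1 := hC ⟨(u : ℂ) + t * Complex.I, by simpa using ht⟩ (by
    rw [him]; nlinarith [n.cast_nonneg (α := ℝ)])
  rw [him, hnt] at h1
  rw [mul_assoc (Real.exp _)]
  refine mul_le_mul ?_ h1 (norm_nonneg _) (Real.exp_nonneg _)
  rw [← Real.exp_nat_mul, one_div, ← Real.exp_neg, Real.exp_le_exp]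
  simp
  nlinarith [Real.pi_pos]

/-! ### Absolute convergence of the lift -/

theorem HalfIntegralPosDef.trace_toMatrix_mul (B : HalfIntegralPosDef)
    (Z : SiegelUpperHalfSpace) :
    (B.toMatrix * Z.1).trace = B.1.1 * Z.1 0 0 + B.1.2.1 * Z.1 0 1 + B.1.2.2 * Z.1 1 1 := by
  have h : Z.1 1 0 = Z.1 0 1 := Z.2.1.apply 0 1
  simp only [HalfIntegralPosDef.toMatrix, Matrix.trace_fin_two, Matrix.mul_apply, Fin.sum_univ_two,
    Matrix.of_apply, Matrix.cons_val', Matrix.cons_val_zero, Matrix.cons_val_one,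
    Matrix.cons_val_fin_one, h]
  ring

theorem norm_qMonomial (B : HalfIntegralPosDef) (Z : SiegelUpperHalfSpace) :
    ‖qMonomial B Z‖ = Real.exp (-(2 * Real.pi * (B.1.1 * (Z.1 0 0).im + B.1.2.1 * (Z.1 0 1).im
      + B.1.2.2 * (Z.1 1 1).im))) := by
  rw [qMonomial, B.trace_toMatrix_mul, Complex.norm_exp]
  congr 1
  simp

theorem HalfIntegralPosDef.pos_right (B : HalfIntegralPosDef) : 0 < B.1.2.2 := by
  obtain ⟨⟨n, r, m⟩, hn, hd⟩ := B
  dsimp only at hn hd ⊢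
  by_contra hm
  nlinarith [sq_nonneg r, mul_nonneg hn.le (neg_nonneg.2 (not_lt.1 hm))]

theorem HalfIntegralPosDef.abs_mid_le (B : HalfIntegralPosDef) :
    |B.1.2.1| ≤ B.1.1 + B.1.2.2 := by
  have hm := B.pos_right
  obtain ⟨⟨n, r, m⟩, hn, hd⟩ := B
  dsimp only at hn hd hm ⊢
  apply abs_le_of_sq_le_sq _ (by linarith)
  nlinarith [sq_nonneg (n - m)]

/-- The size `1 + |n| + |r| + |m|` of a half-integral matrix. -/
def HalfIntegralPosDef.size (B : HalfIntegralPosDef) : ℝ :=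
  1 + (|(B.1.1 : ℝ)| + |(B.1.2.1 : ℝ)| + |(B.1.2.2 : ℝ)|)

theorem HalfIntegralPosDef.one_le_size (B : HalfIntegralPosDef) : 1 ≤ B.size := by
  rw [size]; linarith [abs_nonneg (B.1.1 : ℝ), abs_nonneg (B.1.2.1 : ℝ), abs_nonneg (B.1.2.2 : ℝ)]

theorem exists_size_le_trace (Z : SiegelUpperHalfSpace) : ∃ ε : ℝ, 0 < ε ∧
    ∀ B : HalfIntegralPosDef, ε * (B.size - 1)
      ≤ B.1.1 * (Z.1 0 0).im + B.1.2.1 * (Z.1 0 1).im + B.1.2.2 * (Z.1 1 1).im := by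
  have hpos := Z.2.2
  have h00 : 0 < (Z.1 0 0).im := hpos.diag_pos (i := 0)
  have h11 : 0 < (Z.1 1 1).im := hpos.diag_pos (i := 1)
  have hdet : 0 < (Z.1 0 0).im * (Z.1 1 1).im - (Z.1 0 1).im ^ 2 := by
    have h : Z.1 1 0 = Z.1 0 1 := Z.2.1.apply 0 1
    have := hpos.det_pos
    rw [Matrix.det_fin_two] at this
    simp only [Matrix.map_apply, h] at this
    linarith
  set a := (Z.1 0 0).im
  set b := (Z.1 0 1).im
  set d := (Z.1 1 1).im
  have had : 0 < a + d := by linarith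
  -- det Y / tr Y is at most the smaller eigenvalue of Y = Im Z, so Y - ε is positive semidefinite
  -- and tr(BY) ≥ ε(n + m). The half in the witness pays for |r| ≤ n + m.
  set ε := (a * d - b ^ 2) / (a + d) with hε
  have hε0 : 0 < ε := div_pos hdet had
  have hεe : ε * (a + d) = a * d - b ^ 2 := div_mul_cancel₀ _ had.ne'
  have hεa : ε ≤ a := by rw [hε, div_le_iff₀ had]; nlinarith [sq_nonneg b, sq_nonneg a]
  have hεd : ε ≤ d := by rw [hε, div_le_iff₀ had]; nlinarith [sq_nonneg b, sq_nonneg d]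
  refine ⟨ε / 2, by positivity, fun B ↦ ?_⟩
  have hm := B.pos_right
  have hr := B.abs_mid_le
  obtain ⟨⟨n, r, m⟩, hn, hdisc⟩ := B
  dsimp only [HalfIntegralPosDef.size] at hn hdisc hm hr ⊢
  have hn' : (0 : ℝ) < n := by exact_mod_cast hn
  have hm' : (0 : ℝ) < m := by exact_mod_cast hm
  have hr' : |(r : ℝ)| ≤ n + m := by exact_mod_cast hr
  have hd' : (0 : ℝ) < 4 * n * m - r ^ 2 := by exact_mod_cast hdisc
  rw [abs_of_pos hn', abs_of_pos hm']
  have key : -(r * b) ≤ n * (a - ε) + m * (d - ε) := by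
    have hX : 0 ≤ n * (a - ε) + m * (d - ε) :=
      add_nonneg (mul_nonneg hn'.le (by linarith)) (mul_nonneg hm'.le (by linarith))
    have hprod : b ^ 2 ≤ (a - ε) * (d - ε) := by nlinarith [sq_nonneg ε]
    have hsq : (r * b) ^ 2 ≤ (n * (a - ε) + m * (d - ε)) ^ 2 := by
      have h1 : (r : ℝ) ^ 2 * b ^ 2 ≤ (4 * n * m) * ((a - ε) * (d - ε)) :=
        mul_le_mul (by linarith) hprod (sq_nonneg _) (by positivity)
      nlinarith [sq_nonneg (n * (a - ε) - m * (d - ε))]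
    exact (neg_le_abs _).trans (abs_le_of_sq_le_sq hsq hX)
  nlinarith

theorem summable_exp_neg_mul_abs {δ : ℝ} (hδ : 0 < δ) :
    Summable fun n : ℤ ↦ Real.exp (-(δ * |(n : ℝ)|)) := by
  have h : Summable fun n : ℕ ↦ Real.exp (-(δ * n)) := by
    have := Real.summable_exp_nat_mul_iff.2 (neg_neg_of_pos hδ)
    refine this.congr fun n ↦ ?_
    congr 1; ring
  refine Summable.of_nat_of_neg ?_ ?_ <;> simpa using h

theorem summable_exp_neg_size {δ : ℝ} (hδ : 0 < δ) :
    Summable fun B : HalfIntegralPosDef ↦ Real.exp (-(δ * (B.size - 1))) := by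
  have h := summable_exp_neg_mul_abs hδ
  have h3 := h.mul_of_nonneg (h.mul_of_nonneg h (fun _ ↦ Real.exp_nonneg _)
    fun _ ↦ Real.exp_nonneg _) (fun _ ↦ Real.exp_nonneg _)
    fun _ ↦ mul_nonneg (Real.exp_nonneg _) (Real.exp_nonneg _)
  refine (h3.comp_injective Subtype.val_injective).congr fun B ↦ ?_
  simp only [Function.comp_apply, HalfIntegralPosDef.size]
  rw [← Real.exp_add, ← Real.exp_add]
  congr 1; ring

theorem norm_skCoeff_le {k N : ℕ} {c : ℕ → ℂ} {C : ℝ} (hC : 0 ≤ C) {K : ℕ}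
    (hc : ∀ n : ℕ, ‖c n‖ ≤ C * ((n : ℝ) + 1) ^ K) (B : HalfIntegralPosDef) :
    ‖skCoeff k N c B‖ ≤ C * B.size ^ (1 + k + 2 * K) := by
  have hs := B.one_le_size
  have hcont : (B.content : ℝ) ≤ B.size := by
    have h1 : B.content ≤ B.1.1.natAbs :=
      Nat.le_of_dvd (Int.natAbs_pos.2 B.2.1.ne') (Nat.gcd_dvd_left _ _)
    have h2 : (B.content : ℝ) ≤ |(B.1.1 : ℝ)| := by
      rw [← Int.cast_abs, Int.abs_eq_natAbs]; exact_mod_cast h1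
    rw [HalfIntegralPosDef.size]
    linarith [abs_nonneg (B.1.2.1 : ℝ), abs_nonneg (B.1.2.2 : ℝ)]
  have hdisc : (B.disc : ℝ) + 1 ≤ B.size ^ 2 := by
    have hm := B.pos_right
    have h1 : (B.disc : ℤ) = 4 * B.1.1 * B.1.2.2 - B.1.2.1 ^ 2 := Int.toNat_of_nonneg B.2.2.le
    have h2 : (B.disc : ℝ) = 4 * B.1.1 * B.1.2.2 - B.1.2.1 ^ 2 := by exact_mod_cast h1
    have hn' : (0 : ℝ) < B.1.1 := by exact_mod_cast B.2.1
    have hm' : (0 : ℝ) < B.1.2.2 := by exact_mod_cast hm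
    rw [h2, HalfIntegralPosDef.size, abs_of_pos hn', abs_of_pos hm']
    have hr := abs_nonneg (B.1.2.1 : ℝ)
    have : (1 + ((B.1.1 : ℝ) + B.1.2.2)) ^ 2
        ≤ (1 + ((B.1.1 : ℝ) + |(B.1.2.1 : ℝ)| + B.1.2.2)) ^ 2 :=
      pow_le_pow_left₀ (by positivity) (by linarith) 2
    nlinarith [sq_nonneg ((B.1.1 : ℝ) - B.1.2.2), sq_nonneg (B.1.2.1 : ℝ)]
  rw [skCoeff]
  have hterm : ∀ d ∈ B.content.divisors.filter fun d ↦ d.Coprime N,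
      ‖(d : ℂ) ^ k * c (B.disc / d ^ 2)‖ ≤ B.size ^ k * (C * (B.size ^ 2) ^ K) := by
    intro d hd
    have hd1 := Nat.divisor_le (Finset.mem_filter.1 hd).1
    rw [norm_mul, norm_pow, Complex.norm_natCast]
    refine mul_le_mul (pow_le_pow_left₀ (Nat.cast_nonneg _)
      ((Nat.cast_le.2 hd1).trans hcont) _) ((hc _).trans ?_) (norm_nonneg _) (by positivity)
    refine mul_le_mul_of_nonneg_left (pow_le_pow_left₀ (by positivity) ?_ _) hC
    refine le_trans ?_ hdisc
    gcongr
    exact Nat.div_le_self _ _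
  refine (norm_sum_le_of_le _ hterm).trans ?_
  rw [Finset.sum_const, nsmul_eq_mul]
  have hcard : (((B.content.divisors.filter fun d ↦ d.Coprime N).card : ℕ) : ℝ) ≤ B.size :=
    (Nat.cast_le.2 ((Finset.card_filter_le _ _).trans (Nat.card_divisors_le_self _))).trans hcont
  calc _ ≤ B.size * (B.size ^ k * (C * (B.size ^ 2) ^ K)) :=
        mul_le_mul_of_nonneg_right hcard (by positivity)
    _ = _ := by ring

theorem summable_skCoeff_mul_qMonomial {k N : ℕ} {c : ℕ → ℂ} {C : ℝ} (hC : 0 ≤ C) {K : ℕ}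
    (hc : ∀ n : ℕ, ‖c n‖ ≤ C * ((n : ℝ) + 1) ^ K) (Z : SiegelUpperHalfSpace) :
    Summable fun B : HalfIntegralPosDef ↦ skCoeff k N c B * qMonomial B Z := by
  obtain ⟨ε, hε, hZ⟩ := exists_size_le_trace Z
  set L := 1 + k + 2 * K with hL
  have hδ : 0 < Real.pi * ε := by positivity
  refine Summable.of_norm_bounded (((summable_exp_neg_size hδ).mul_left
    (C * (L.factorial / (Real.pi * ε) ^ L * Real.exp (Real.pi * ε))))) fun B ↦ ?_
  have hs := B.one_le_size
  rw [norm_mul, norm_qMonomial]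
  -- Half of the decay rate 2πε absorbs the polynomial factor, by x^L / L! ≤ eˣ with x = πε·size.
  have h1 : B.size ^ L ≤ L.factorial / (Real.pi * ε) ^ L * Real.exp (Real.pi * ε * B.size) := by
    have := Real.pow_div_factorial_le_exp (Real.pi * ε * B.size) (by positivity) L
    rw [div_le_iff₀ (by positivity), mul_pow] at this
    rw [div_mul_eq_mul_div, le_div_iff₀ (by positivity)]
    linarith
  calc _ ≤ C * (L.factorial / (Real.pi * ε) ^ L * Real.exp (Real.pi * ε * B.size))
        * Real.exp (-(2 * Real.pi * (ε * (B.size - 1)))) := by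
        refine mul_le_mul ((norm_skCoeff_le hC hc B).trans (mul_le_mul_of_nonneg_left h1 hC)) ?_
          (Real.exp_nonneg _) (by positivity)
        rw [Real.exp_le_exp, neg_le_neg_iff]
        exact mul_le_mul_of_nonneg_left (hZ B) (by positivity)
    _ = C * (L.factorial / (Real.pi * ε) ^ L) * (Real.exp (Real.pi * ε * B.size)
        * Real.exp (-(2 * Real.pi * (ε * (B.size - 1))))) := by ring
    _ = C * (L.factorial / (Real.pi * ε) ^ L) * (Real.exp (Real.pi * ε)
        * Real.exp (-(Real.pi * ε * (B.size - 1)))) := by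
        rw [← Real.exp_add, ← Real.exp_add]; congr 2; ring
    _ = _ := by ring

end SaitoKurokawa

/-! ### Expansions over integral triples and the operators acting on them -/

noncomputable section

namespace SaitoKurokawa

theorem _root_.HasSum.congr_term {ι : Type*} {f g : ι → ℂ} {a : ℂ} (h : HasSum f a)
    (hfg : ∀ i, g i = f i) : HasSum g a := by
  rwa [show g = f from funext hfg]

/-- `e(x) = exp(2πix)`. -/
def expTwoPiI (x : ℂ) : ℂ := Complex.exp (2 * Real.pi * Complex.I * x)

theorem expTwoPiI_add (x y : ℂ) : expTwoPiI (x + y) = expTwoPiI x * expTwoPiI y := by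
  rw [expTwoPiI, mul_add, Complex.exp_add]; rfl

theorem inv_mul_sum_expTwoPiI {p : ℕ} (hp : 0 < p) (n : ℤ) :
    (p : ℂ)⁻¹ * ∑ b ∈ Finset.range p, expTwoPiI (n * (b : ℤ) / p)
      = if (p : ℤ) ∣ n then 1 else 0 := by
  have hp0 : (p : ℂ) ≠ 0 := by exact_mod_cast hp.ne'
  have hpow (b : ℕ) : expTwoPiI (n * (b : ℤ) / p) = expTwoPiI (n / p) ^ b := by
    rw [expTwoPiI, expTwoPiI, ← Complex.exp_nat_mul]
    congr 1; push_cast; ring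
  simp only [hpow]
  split_ifs with h
  · obtain ⟨m, rfl⟩ := h
    have : expTwoPiI (((p * m : ℤ) : ℂ) / p) = 1 := by
      rw [expTwoPiI, Complex.exp_eq_one_iff]
      exact ⟨m, by push_cast; field_simp⟩
    rw [this]; simp [hp0]
  · have hne : expTwoPiI ((n : ℂ) / p) ≠ 1 := by
      rw [expTwoPiI, Ne, Complex.exp_eq_one_iff]
      rintro ⟨m, hm⟩
      apply h
      refine ⟨m, ?_⟩
      have h2 : (2 * Real.pi * Complex.I : ℂ) ≠ 0 := Complex.two_pi_I_ne_zero
      rw [mul_comm (m : ℂ)] at hm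
      have := mul_left_cancel₀ h2 hm
      rw [div_eq_iff hp0] at this
      have h3 : n = m * p := by exact_mod_cast this
      rw [h3, mul_comm]
    have h1 : expTwoPiI ((n : ℂ) / p) ^ p = 1 := by
      rw [← hpow, expTwoPiI, Complex.exp_eq_one_iff]
      exact ⟨n, by push_cast; field_simp⟩
    rw [geom_sum_eq hne, h1]; simp

/-- The monomial `q₁ⁿ q₂ᵐ` attached to the triple `(n, r, m)`. -/
def diagMonomial (b : ℤ × ℤ × ℤ) (τ : ℍ × ℍ) : ℂ :=
  expTwoPiI (b.1 * (τ.1 : ℂ) + b.2.2 * (τ.2 : ℂ))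

/-- `φ(τ₁, τ₂) = ∑ g(n, r, m) q₁ⁿ q₂ᵐ` with absolute convergence on all of `ℍ × ℍ`. -/
def HasDiagExpansion (g : ℤ × ℤ × ℤ → ℂ) (φ : ℍ × ℍ → ℂ) : Prop :=
  ∀ τ, HasSum (fun b ↦ g b * diagMonomial b τ) (φ τ)

namespace HasDiagExpansion

variable {g g' : ℤ × ℤ × ℤ → ℂ} {φ φ' : ℍ × ℍ → ℂ}

/-- Coefficients determine the function, but not conversely, since r is redundant; only this
direction is used. -/
theorem unique (h : HasDiagExpansion g φ) (h' : HasDiagExpansion g φ') : φ = φ' :=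
  funext fun τ ↦ (h τ).unique (h' τ)

theorem add (h : HasDiagExpansion g φ) (h' : HasDiagExpansion g' φ') :
    HasDiagExpansion (g + g') (φ + φ') := fun τ ↦ by
  simpa only [Pi.add_apply, add_mul] using (h τ).add (h' τ)

theorem sub (h : HasDiagExpansion g φ) (h' : HasDiagExpansion g' φ') :
    HasDiagExpansion (g - g') (φ - φ') := fun τ ↦ by
  simpa only [Pi.sub_apply, sub_mul] using (h τ).sub (h' τ)

theorem smul (c : ℂ) (h : HasDiagExpansion g φ) : HasDiagExpansion (c • g) (c • φ) := fun τ ↦ by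
  simpa only [Pi.smul_apply, smul_eq_mul, mul_assoc] using (h τ).mul_left c

theorem opUU {p : ℕ} (hp : 0 < p) (h : HasDiagExpansion g φ) :
    HasDiagExpansion (fun b ↦ g (p * b.1, b.2.1, p * b.2.2)) (opUU p hp φ) := by
  intro τ
  have hp0 : (p : ℂ) ≠ 0 := by exact_mod_cast hp.ne'
  let u (b : ℤ × ℤ × ℤ) : ℂ := expTwoPiI (b.1 * (τ.1 : ℂ) / p) * expTwoPiI (b.2.2 * (τ.2 : ℂ) / p)
  have hmono (b : ℤ × ℤ × ℤ) (b₁ b₂ : ℕ) :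
      diagMonomial b (shiftDiv p hp b₁ τ.1, shiftDiv p hp b₂ τ.2)
        = u b * (expTwoPiI (b.1 * (b₁ : ℤ) / p) * expTwoPiI (b.2.2 * (b₂ : ℤ) / p)) := by
    simp only [u, diagMonomial, ← expTwoPiI_add]
    congr 1
    simp only [shiftDiv]
    field_simp
    ring
  have hs : HasSum (fun b ↦ g b * u b *
      ((if (p : ℤ) ∣ b.1 then 1 else 0) * (if (p : ℤ) ∣ b.2.2 then 1 else 0)))
      (SaitoKurokawa.opUU p hp φ τ) := by
    have h1 := (hasSum_sum (s := Finset.range p) fun b₁ _ ↦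
      (hasSum_sum (s := Finset.range p) fun b₂ _ ↦
        h (shiftDiv p hp b₁ τ.1, shiftDiv p hp b₂ τ.2)).mul_left (p : ℂ)⁻¹).mul_left (p : ℂ)⁻¹
    refine HasSum.congr_term h1 fun b ↦ ?_
    simp only [hmono, ← inv_mul_sum_expTwoPiI hp, ← Finset.mul_sum, ← Finset.sum_mul]
    ring
  have hinj : Function.Injective fun b : ℤ × ℤ × ℤ ↦ ((p * b.1, b.2.1, p * b.2.2) : ℤ × ℤ × ℤ) := by
    rintro ⟨n, r, m⟩ ⟨n', r', m'⟩ he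
    simpa [hp.ne'] using he
  rw [← hinj.hasSum_iff] at hs
  · convert hs using 1
    funext b
    simp only [Function.comp_apply, u, dvd_mul_right, if_true, mul_one, diagMonomial,
      ← expTwoPiI_add]
    congr 2
    push_cast
    field_simp
  · rintro ⟨n, r, m⟩ hb
    by_cases h1 : (p : ℤ) ∣ n
    · by_cases h2 : (p : ℤ) ∣ m
      · obtain ⟨n, rfl⟩ := h1
        obtain ⟨m, rfl⟩ := h2
        exact absurd ⟨(n, r, m), rfl⟩ hb
      · simp [h2]
    · simp [h1]

/-- Dividing r by p as well is a free choice of labelling; it makes the coefficients A(b/p), as the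
recursion requires. -/
theorem opVV {p : ℕ} (hp : 0 < p) (h : HasDiagExpansion g φ)
    (hg : ∀ b : ℤ × ℤ × ℤ, g' (p * b.1, p * b.2.1, p * b.2.2) = g b)
    (hg' : ∀ b : ℤ × ℤ × ℤ, ¬ ((p : ℤ) ∣ b.1 ∧ (p : ℤ) ∣ b.2.1 ∧ (p : ℤ) ∣ b.2.2) → g' b = 0) :
    HasDiagExpansion g' (opVV p hp φ) := by
  intro τ
  have hinj : Function.Injective
      fun b : ℤ × ℤ × ℤ ↦ ((p * b.1, p * b.2.1, p * b.2.2) : ℤ × ℤ × ℤ) := by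
    rintro ⟨n, r, m⟩ ⟨n', r', m'⟩ he
    simpa [hp.ne'] using he
  rw [← hinj.hasSum_iff]
  · refine HasSum.congr_term (h (scale p hp τ.1, scale p hp τ.2)) fun b ↦ ?_
    simp only [Function.comp_apply, hg, diagMonomial, scale]
    congr 2
    push_cast
    ring
  · rintro ⟨n, r, m⟩ hb
    rw [hg', zero_mul]
    rintro ⟨⟨n, rfl⟩, ⟨r, rfl⟩, ⟨m, rfl⟩⟩
    exact hb ⟨(n, r, m), rfl⟩

/-- The monomial ignores r, so a family supported on p ∣ r may be relabelled without changing its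
sum. -/
theorem mul_mid {p : ℤ} (hp : p ≠ 0) (h : HasDiagExpansion g φ)
    (hg : ∀ b : ℤ × ℤ × ℤ, ¬ p ∣ b.2.1 → g b = 0) :
    HasDiagExpansion (fun b ↦ g (b.1, p * b.2.1, b.2.2)) φ := by
  intro τ
  have hinj : Function.Injective fun b : ℤ × ℤ × ℤ ↦ ((b.1, p * b.2.1, b.2.2) : ℤ × ℤ × ℤ) := by
    rintro ⟨n, r, m⟩ ⟨n', r', m'⟩ he
    simpa [hp] using he
  have hs := h τ
  rw [← hinj.hasSum_iff] at hs
  · exact hs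
  · rintro ⟨n, r, m⟩ hb
    rw [hg, zero_mul]
    rintro ⟨r, rfl⟩
    exact hb ⟨(n, r, m), rfl⟩

end HasDiagExpansion

/-- The expansion `Φ(Z) = ∑ g(n, r, m) e(n z₁₁ + r z₁₂ + m z₂₂)` with absolute convergence on all
of the Siegel upper half-space. -/
def HasSiegelExpansion (g : ℤ × ℤ × ℤ → ℂ) (Φ : SiegelUpperHalfSpace → ℂ) : Prop :=
  ∀ Z : SiegelUpperHalfSpace,
    HasSum (fun b ↦ g b * expTwoPiI (b.1 * Z.1 0 0 + b.2.1 * Z.1 0 1 + b.2.2 * Z.1 1 1)) (Φ Z)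

namespace HasSiegelExpansion

variable {g : ℤ × ℤ × ℤ → ℂ} {Φ : SiegelUpperHalfSpace → ℂ}

theorem pullback (h : HasSiegelExpansion g Φ) : HasDiagExpansion g (pullback Φ) := fun τ ↦ by
  refine HasSum.congr_term (h (siegelDiag τ.1 τ.2)) fun b ↦ ?_
  simp [diagMonomial, siegelDiag]

theorem siegelU {p : ℕ} (hp : 0 < p) (h : HasSiegelExpansion g Φ) :
    HasSiegelExpansion (fun b ↦ g (p * b.1, p * b.2.1, p * b.2.2)) (siegelU p hp Φ) := by
  intro Z
  have hp0 : (p : ℂ) ≠ 0 := by exact_mod_cast hp.ne'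
  let u (b : ℤ × ℤ × ℤ) : ℂ :=
    expTwoPiI ((b.1 * Z.1 0 0 + b.2.1 * Z.1 0 1 + b.2.2 * Z.1 1 1) / p)
  have hmono (b : ℤ × ℤ × ℤ) (b₁ b₂ b₃ : ℕ) :
      expTwoPiI (b.1 * (siegelShiftDiv p hp b₁ b₂ b₃ Z).1 0 0
          + b.2.1 * (siegelShiftDiv p hp b₁ b₂ b₃ Z).1 0 1
          + b.2.2 * (siegelShiftDiv p hp b₁ b₂ b₃ Z).1 1 1)
        = u b * (expTwoPiI (b.1 * (b₁ : ℤ) / p) * expTwoPiI (b.2.1 * (b₂ : ℤ) / p)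
          * expTwoPiI (b.2.2 * (b₃ : ℤ) / p)) := by
    simp only [u, ← expTwoPiI_add]
    congr 1
    simp [siegelShiftDiv]
    field_simp
    ring
  have hs : HasSum (fun b ↦ g b * u b *
      ((if (p : ℤ) ∣ b.1 then 1 else 0) * (if (p : ℤ) ∣ b.2.1 then 1 else 0)
        * (if (p : ℤ) ∣ b.2.2 then 1 else 0)))
      (SaitoKurokawa.siegelU p hp Φ Z) := by
    have h1 := (hasSum_sum (s := Finset.range p) fun b₁ _ ↦
      hasSum_sum (s := Finset.range p) fun b₂ _ ↦ hasSum_sum (s := Finset.range p) fun b₃ _ ↦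
        h (siegelShiftDiv p hp b₁ b₂ b₃ Z)).mul_left ((p : ℂ) ^ 3)⁻¹
    refine HasSum.congr_term h1 fun b ↦ ?_
    simp only [hmono, ← inv_mul_sum_expTwoPiI hp, ← Finset.mul_sum, ← Finset.sum_mul]
    field_simp
  have hinj : Function.Injective
      fun b : ℤ × ℤ × ℤ ↦ ((p * b.1, p * b.2.1, p * b.2.2) : ℤ × ℤ × ℤ) := by
    rintro ⟨n, r, m⟩ ⟨n', r', m'⟩ he
    simpa [hp.ne'] using he
  rw [← hinj.hasSum_iff] at hs
  · convert hs using 1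
    funext b
    simp only [Function.comp_apply, u, dvd_mul_right, if_true, mul_one]
    congr 2
    push_cast
    field_simp
  · rintro ⟨n, r, m⟩ hb
    by_cases h1 : (p : ℤ) ∣ n
    · by_cases h2 : (p : ℤ) ∣ m
      · by_cases h3 : (p : ℤ) ∣ r
        · obtain ⟨n, rfl⟩ := h1
          obtain ⟨m, rfl⟩ := h2
          obtain ⟨r, rfl⟩ := h3
          exact absurd ⟨(n, r, m), rfl⟩ hb
        · simp [h3]
      · simp [h2]
    · simp [h1]

end HasSiegelExpansion

/-- The coefficients of the Saito--Kurokawa lift, extended by zero to all triples of integers. -/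
def skCoeffExt (k N : ℕ) (c : ℕ → ℂ) (b : ℤ × ℤ × ℤ) : ℂ :=
  open Classical in
  if hb : 0 < b.1 ∧ 0 < 4 * b.1 * b.2.2 - b.2.1 ^ 2 then skCoeff k N c ⟨b, hb⟩ else 0

theorem hasSiegelExpansion_skLift {k N : ℕ} {h : ℍ → ℂ}
    (hs : ∀ Z, Summable fun B : HalfIntegralPosDef ↦ skCoeff k N (qCoeff h) B * qMonomial B Z) :
    HasSiegelExpansion (skCoeffExt k N (qCoeff h)) (skLift k N h) := by
  intro Z
  rw [← (Subtype.val_injective : Function.Injective fun B : HalfIntegralPosDef ↦ B.1).hasSum_iff]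
  · refine HasSum.congr_term (hs Z).hasSum fun B ↦ ?_
    simp only [Function.comp_apply, skCoeffExt, dif_pos B.2, qMonomial, expTwoPiI,
      HalfIntegralPosDef.trace_toMatrix_mul]
  · intro b hb
    rw [skCoeffExt, dif_neg, zero_mul]
    exact fun h ↦ hb ⟨⟨b, h⟩, rfl⟩

/-! ### Divisor sums and the Hecke relation at p -/

/-- The part of `∑_{d ∣ g, (d, N) = 1} d^k c(D / d²)` with `p ∤ d`. -/
def primeToSum (k N p : ℕ) (c : ℕ → ℂ) (D g : ℕ) : ℂ :=
  ∑ d ∈ (g.divisors.filter fun d ↦ d.Coprime N) with ¬ p ∣ d, (d : ℂ) ^ k * c (D / d ^ 2)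

/-- `∑_{d ∣ g, (d, N) = 1} d^k c(D / d²)`. -/
def divisorSum (k N : ℕ) (c : ℕ → ℂ) (D g : ℕ) : ℂ :=
  ∑ d ∈ g.divisors with d.Coprime N, (d : ℂ) ^ k * c (D / d ^ 2)

variable {k N p : ℕ} {c : ℕ → ℂ}

theorem primeToSum_mul (hp : p.Prime) {D g : ℕ} (hg : g ≠ 0) :
    primeToSum k N p c D (p * g) = primeToSum k N p c D g := by
  rw [primeToSum, primeToSum]
  congr 1
  ext d
  simp only [Finset.mem_filter, Nat.mem_divisors]
  constructor
  · rintro ⟨⟨⟨h1, -⟩, h2⟩, h3⟩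
    exact ⟨⟨⟨(((hp.coprime_iff_not_dvd).2 h3).symm.dvd_mul_left).1 h1, hg⟩, h2⟩, h3⟩
  · rintro ⟨⟨⟨h1, -⟩, h2⟩, h3⟩
    exact ⟨⟨⟨h1.mul_left p, mul_ne_zero hp.ne_zero hg⟩, h2⟩, h3⟩

/-- Split according to p ∣ d. In the terms d = pd', the factor p² of the discriminant cancels
against that of d². -/
theorem divisorSum_mul (hp : p.Prime) (hpN : ¬ p ∣ N) {D g : ℕ} (hg : g ≠ 0) :
    divisorSum k N c (p ^ 2 * D) (p * g)
      = primeToSum k N p c (p ^ 2 * D) g + (p : ℂ) ^ k * divisorSum k N c D g := by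
  rw [← primeToSum_mul hp hg, divisorSum, primeToSum, add_comm,
    ← Finset.sum_filter_add_sum_filter_not _ (fun d ↦ p ∣ d)]
  congr 1
  rw [divisorSum, Finset.mul_sum]
  refine (Finset.sum_bij (fun d _ ↦ p * d) ?_ ?_ ?_ ?_).symm
  · intro d hd
    simp only [Finset.mem_filter, Nat.mem_divisors] at hd ⊢
    exact ⟨⟨⟨mul_dvd_mul_left p hd.1.1, mul_ne_zero hp.ne_zero hg⟩,
      ((hp.coprime_iff_not_dvd).2 hpN).mul_left hd.2⟩, dvd_mul_right p d⟩
  · intro a _ b _ h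
    exact Nat.eq_of_mul_eq_mul_left hp.pos h
  · intro d hd
    simp only [Finset.mem_filter, Nat.mem_divisors] at hd
    obtain ⟨⟨⟨h1, -⟩, h2⟩, d, rfl⟩ := hd
    refine ⟨d, ?_, rfl⟩
    simp only [Finset.mem_filter, Nat.mem_divisors]
    exact ⟨⟨Nat.dvd_of_mul_dvd_mul_left hp.pos h1, hg⟩, h2.coprime_mul_left⟩
  · intro d _
    rw [mul_pow p d 2, Nat.mul_div_mul_left _ _ (pow_pos hp.pos 2)]
    push_cast
    ring

theorem primeToSum_eq_divisorSum {D g : ℕ} (hg : ¬ p ∣ g) :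
    primeToSum k N p c D g = divisorSum k N c D g := by
  rw [primeToSum, divisorSum, Finset.filter_true_of_mem]
  intro d hd h
  exact hg (h.trans (Nat.dvd_of_mem_divisors (Finset.mem_filter.1 hd).1))

theorem kroneckerPrime_of_dvd {a : ℤ} (hp : p.Prime) (hp2 : p ≠ 2) (h : (p : ℤ) ∣ a) :
    kroneckerPrime a p = 0 := by
  rw [kroneckerPrime, if_neg hp2]
  have : NeZero p := ⟨hp.ne_zero⟩
  rw [jacobiSym.eq_zero_iff_not_coprime, Int.gcd_eq_natAbs, Int.natAbs_natCast]
  exact fun h1 ↦ (hp.coprime_iff_not_dvd.1 (Nat.coprime_comm.1 h1)) (Int.natCast_dvd.1 h)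

theorem kroneckerPrime_of_modEq_sq {a s : ℤ} (hp : p.Prime) (hp2 : p ≠ 2) (hs : ¬ (p : ℤ) ∣ s)
    (h : a ≡ s ^ 2 [ZMOD p]) : kroneckerPrime a p = 1 := by
  rw [kroneckerPrime, if_neg hp2, jacobiSym.mod_left' h, jacobiSym.pow_left]
  apply jacobiSym.sq_one
  rw [Int.gcd_comm]
  exact Int.isCoprime_iff_gcd_eq_one.1
    ((Nat.prime_iff_prime_int.1 hp).coprime_iff_not_dvd.2 hs)

/-- Termwise Hecke relation for `D` divisible by `p²`. -/
theorem primeToSum_hecke (hp : p.Prime) (hp2 : p ≠ 2) {a : ℂ} {D g : ℕ}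
    (hD : ∀ d : ℕ, d ∣ g → d ^ 2 ∣ D)
    (hc : ∀ d : ℕ, d ∣ g → heckeSqCoeff k p c (p ^ 2 * (D / d ^ 2)) = a * c (p ^ 2 * (D / d ^ 2))) :
    primeToSum k N p c (p ^ 2 * (p ^ 2 * D)) g + (p : ℂ) ^ (2 * k - 1) * primeToSum k N p c D g
      = a * primeToSum k N p c (p ^ 2 * D) g := by
  simp only [primeToSum, Finset.mul_sum, ← Finset.sum_add_distrib]
  refine Finset.sum_congr rfl fun d hd ↦ ?_
  have hdg := Nat.dvd_of_mem_divisors (Finset.mem_filter.1 (Finset.mem_filter.1 hd).1).1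
  have h1 := hc d hdg
  rw [heckeSqCoeff, kroneckerPrime_of_dvd hp hp2
    (Dvd.dvd.mul_left (Int.natCast_dvd_natCast.2
      ((dvd_pow_self p two_ne_zero).mul_right _)) _),
    if_pos (dvd_mul_right _ _), Nat.mul_div_cancel_left _ (pow_pos hp.pos 2)] at h1
  rw [Nat.mul_div_assoc _ ((hD d hdg).mul_left _), Nat.mul_div_assoc _ (hD d hdg)]
  linear_combination (d : ℂ) ^ k * h1

/-- Termwise Hecke relation for `D` prime to `p` with `((-1)^k D / p) = 1`. -/
theorem primeToSum_hecke_of_not_dvd {a : ℂ} {D g : ℕ}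
    (hD : ∀ d : ℕ, d ∣ g → d ^ 2 ∣ D) (hpD : ¬ p ∣ D)
    (hχ : ∀ d : ℕ, d ∣ g → kroneckerPrime ((-1) ^ k * ((D / d ^ 2 : ℕ) : ℤ)) p = 1)
    (hc : ∀ d : ℕ, d ∣ g → heckeSqCoeff k p c (D / d ^ 2) = a * c (D / d ^ 2)) :
    primeToSum k N p c (p ^ 2 * D) g = (a - (p : ℂ) ^ (k - 1)) * primeToSum k N p c D g := by
  simp only [primeToSum, Finset.mul_sum]
  refine Finset.sum_congr rfl fun d hd ↦ ?_
  have hdg := Nat.dvd_of_mem_divisors (Finset.mem_filter.1 (Finset.mem_filter.1 hd).1).1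
  have h1 := hc d hdg
  have h2 : ¬ p ^ 2 ∣ D / d ^ 2 := fun h ↦
    hpD (((dvd_pow_self p two_ne_zero).trans h).trans (Nat.div_dvd_of_dvd (hD d hdg)))
  rw [heckeSqCoeff, hχ d hdg, if_neg h2] at h1
  rw [Nat.mul_div_assoc _ (hD d hdg)]
  push_cast at h1
  linear_combination (d : ℂ) ^ k * h1

/-! ### Discriminant and content of integral triples -/

/-- `4nm - r²`, for a triple `(n, r, m)`. -/
def tripleDisc (b : ℤ × ℤ × ℤ) : ℤ := 4 * b.1 * b.2.2 - b.2.1 ^ 2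

/-- `gcd(n, r, m)`, for a triple `(n, r, m)`. -/
def tripleContent (b : ℤ × ℤ × ℤ) : ℕ := Nat.gcd b.1.natAbs (Nat.gcd b.2.1.natAbs b.2.2.natAbs)

/-- The triple `(n, r, m)` belongs to a positive definite matrix. -/
def TriplePosDef (b : ℤ × ℤ × ℤ) : Prop := 0 < b.1 ∧ 0 < tripleDisc b

theorem tripleDisc_smul (q : ℤ) (b : ℤ × ℤ × ℤ) : tripleDisc (q • b) = q ^ 2 * tripleDisc b := by
  simp only [tripleDisc, Prod.smul_fst, Prod.smul_snd, smul_eq_mul]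
  ring

theorem tripleContent_smul (q : ℕ) (b : ℤ × ℤ × ℤ) :
    tripleContent ((q : ℤ) • b) = q * tripleContent b := by
  simp only [tripleContent, Prod.smul_fst, Prod.smul_snd, smul_eq_mul, Int.natAbs_mul,
    Int.natAbs_natCast, Nat.gcd_mul_left]

theorem triplePosDef_smul {q : ℤ} (hq : 0 < q) (b : ℤ × ℤ × ℤ) :
    TriplePosDef (q • b) ↔ TriplePosDef b := by
  rw [TriplePosDef, TriplePosDef, tripleDisc_smul, Prod.smul_fst, smul_eq_mul,
    mul_pos_iff_of_pos_left hq, mul_pos_iff_of_pos_left (by positivity)]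

theorem exists_eq_smul_of_dvd_tripleContent {d : ℕ} {b : ℤ × ℤ × ℤ} (h : d ∣ tripleContent b) :
    ∃ b', b = (d : ℤ) • b' := by
  obtain ⟨n, r, m⟩ := b
  rw [tripleContent, Nat.dvd_gcd_iff, Nat.dvd_gcd_iff] at h
  obtain ⟨⟨n, rfl⟩, ⟨r, rfl⟩, ⟨m, rfl⟩⟩ :=
    And.imp Int.natCast_dvd.2 (And.imp Int.natCast_dvd.2 Int.natCast_dvd.2) h
  exact ⟨(n, r, m), rfl⟩

theorem tripleContent_ne_zero {b : ℤ × ℤ × ℤ} (h : TriplePosDef b) : tripleContent b ≠ 0 := by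
  rw [tripleContent]
  exact (Nat.gcd_pos_of_pos_left _ (Int.natAbs_pos.2 h.1.ne')).ne'

theorem toNat_tripleDisc_smul (q : ℕ) (b : ℤ × ℤ × ℤ) :
    (tripleDisc ((q : ℤ) • b)).toNat = q ^ 2 * (tripleDisc b).toNat := by
  have e : (q : ℤ) ^ 2 = ((q ^ 2 : ℕ) : ℤ) := by push_cast; rfl
  rw [tripleDisc_smul, e]
  rcases le_total 0 (tripleDisc b) with h | h
  · rw [Int.toNat_mul (by positivity) h, Int.toNat_natCast]
  · rw [Int.toNat_of_nonpos h, mul_zero,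
      Int.toNat_of_nonpos (mul_nonpos_of_nonneg_of_nonpos (by positivity) h)]

/-- For k odd, (-1)^k(4nm - r²) ≡ r² mod 4. -/
theorem isPlusIndex_tripleDisc (hk : Odd k) {b : ℤ × ℤ × ℤ} (h : 0 ≤ tripleDisc b) :
    IsPlusIndex k (tripleDisc b).toNat := by
  rw [IsPlusIndex, Int.toNat_of_nonneg h, hk.neg_one_pow, tripleDisc]
  rcases Int.even_or_odd' b.2.1 with ⟨s, hs | hs⟩
  · left
    rw [hs, Int.modEq_zero_iff_dvd]
    exact ⟨s ^ 2 - b.1 * b.2.2, by ring⟩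
  · right
    rw [hs]
    exact (Int.modEq_iff_dvd.2 ⟨s ^ 2 + s - b.1 * b.2.2, by ring⟩).symm

theorem skCoeffExt_eq (b : ℤ × ℤ × ℤ) (h : TriplePosDef b) :
    skCoeffExt k N c b = divisorSum k N c (tripleDisc b).toNat (tripleContent b) :=
  dif_pos h

theorem skCoeffExt_of_not (b : ℤ × ℤ × ℤ) (h : ¬ TriplePosDef b) : skCoeffExt k N c b = 0 :=
  dif_neg h

/-! ### Recursions for the coefficients of the lift -/

/-- `h` satisfies the Hecke relation at `p` with eigenvalue `a` at all indices of the plus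
space. -/
def HasHeckeEigenvalue (k p : ℕ) (c : ℕ → ℂ) (a : ℂ) : Prop :=
  ∀ n, IsPlusIndex k n → heckeSqCoeff k p c n = a * c n

variable {a : ℂ}

/-- Each index D/d² in the divisor sum is the discriminant of b/d, hence a plus index, so the Hecke
relation applies term by term. -/
theorem dvd_tripleContent {b : ℤ × ℤ × ℤ} {d : ℕ} (h : TriplePosDef b)
    (hd : d ∣ tripleContent b) : ∃ b', b = (d : ℤ) • b' ∧ TriplePosDef b' ∧
      (tripleDisc b).toNat = d ^ 2 * (tripleDisc b').toNat ∧
      (tripleDisc b).toNat / d ^ 2 = (tripleDisc b').toNat := by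
  have hd0 : 0 < d := Nat.pos_of_dvd_of_pos hd (Nat.pos_of_ne_zero (tripleContent_ne_zero h))
  obtain ⟨b', rfl⟩ := exists_eq_smul_of_dvd_tripleContent hd
  refine ⟨b', rfl, (triplePosDef_smul (by exact_mod_cast hd0) b').1 h, toNat_tripleDisc_smul d b',
    ?_⟩
  rw [toNat_tripleDisc_smul, Nat.mul_div_cancel_left _ (pow_pos hd0 2)]

/-- Here p divides neither the content nor D, and -D/d² is a nonzero square mod p for each d. So the
part with p ∤ d contributes a - p^(k-1) and the part with p ∣ d contributes p^k. -/
theorem skCoeffExt_smul_of_not_dvd (hk : Odd k) (hp : p.Prime) (hp2 : p ≠ 2) (hpN : ¬ p ∣ N)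
    (hc : HasHeckeEigenvalue k p c a) {b : ℤ × ℤ × ℤ} (hbn : (p : ℤ) ∣ b.1)
    (hbr : ¬ (p : ℤ) ∣ b.2.1) :
    skCoeffExt k N c ((p : ℤ) • b)
      = ((p : ℂ) ^ k - (p : ℂ) ^ (k - 1) + a) * skCoeffExt k N c b := by
  have hp0 : (0 : ℤ) < p := by exact_mod_cast hp.pos
  by_cases h : TriplePosDef b
  swap
  · rw [skCoeffExt_of_not b h, skCoeffExt_of_not _ (mt (triplePosDef_smul hp0 b).1 h), mul_zero]
  have hpg : ¬ p ∣ tripleContent b := fun hd ↦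
    hbr (Int.natCast_dvd.2 ((hd.trans (Nat.gcd_dvd_right _ _)).trans (Nat.gcd_dvd_left _ _)))
  have hpD (b' : ℤ × ℤ × ℤ) (h1 : (p : ℤ) ∣ b'.1) (h2 : ¬ (p : ℤ) ∣ b'.2.1) :
      ¬ (p : ℤ) ∣ tripleDisc b' := fun hd ↦ h2 <| by
    rw [tripleDisc, dvd_sub_right ((h1.mul_left 4).mul_right _)] at hd
    exact (Nat.prime_iff_prime_int.1 hp).dvd_of_dvd_pow hd
  rw [skCoeffExt_eq _ ((triplePosDef_smul hp0 b).2 h), skCoeffExt_eq b h, toNat_tripleDisc_smul,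
    tripleContent_smul, divisorSum_mul hp hpN (tripleContent_ne_zero h),
    primeToSum_hecke_of_not_dvd (a := a) _ _, primeToSum_eq_divisorSum hpg]
  · ring
  · intro d hd
    obtain ⟨b', rfl, h', -, e⟩ := dvd_tripleContent h hd
    rw [e, Int.toNat_of_nonneg h'.2.le, hk.neg_one_pow]
    have hpd : ¬ p ∣ d := fun hpd ↦ hpg (hpd.trans hd)
    have hbn' : (p : ℤ) ∣ b'.1 :=
      ((Nat.prime_iff_prime_int.1 hp).dvd_or_dvd hbn).resolve_left
        (by rwa [Int.natCast_dvd_natCast])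
    refine kroneckerPrime_of_modEq_sq (s := b'.2.1) hp hp2
      (fun h ↦ hbr (Dvd.dvd.mul_left h _)) (Int.modEq_iff_dvd.2 ?_)
    rw [tripleDisc]
    obtain ⟨n, hn⟩ := hbn'
    rw [hn]
    exact ⟨4 * n * b'.2.2, by ring⟩
  · intro d hd
    obtain ⟨b', -, h', -, e⟩ := dvd_tripleContent h hd
    rw [e]
    exact hc _ (isPlusIndex_tripleDisc hk h'.2.le)
  · intro d hd
    obtain ⟨b', -, -, e, -⟩ := dvd_tripleContent h hd
    exact ⟨_, e⟩
  · intro hd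
    apply hpD b hbn hbr
    rw [← Int.toNat_of_nonneg h.2.le]
    exact Int.natCast_dvd_natCast.2 hd

/-- The coefficients of `Φ(pZ)` if `g` are those of `Φ`. -/
def divCoeff (p : ℕ) (g : ℤ × ℤ × ℤ → ℂ) (b : ℤ × ℤ × ℤ) : ℂ :=
  if (p : ℤ) ∣ b.1 ∧ (p : ℤ) ∣ b.2.1 ∧ (p : ℤ) ∣ b.2.2 then
    g (b.1 / p, b.2.1 / p, b.2.2 / p) else 0

theorem divCoeff_smul (hp : 0 < p) (g : ℤ × ℤ × ℤ → ℂ) (b : ℤ × ℤ × ℤ) :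
    divCoeff p g ((p : ℤ) • b) = g b := by
  have hp0 : (p : ℤ) ≠ 0 := by exact_mod_cast hp.ne'
  rw [divCoeff, if_pos ⟨dvd_mul_right _ _, dvd_mul_right _ _, dvd_mul_right _ _⟩]
  simp only [Prod.smul_fst, Prod.smul_snd, smul_eq_mul, Int.mul_ediv_cancel_left _ hp0]

theorem divCoeff_of_not (g : ℤ × ℤ × ℤ → ℂ) {b : ℤ × ℤ × ℤ}
    (hb : ¬ ((p : ℤ) ∣ b.1 ∧ (p : ℤ) ∣ b.2.1 ∧ (p : ℤ) ∣ b.2.2)) : divCoeff p g b = 0 :=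
  if_neg hb

/-- Let S be the full divisor sum of b and P(·) the part with p ∤ d. Then A(pb) = P(p²D) + p^k S and
A(p²b) = P(p⁴D) + p^k A(pb). The Hecke relation expresses P(p⁴D) by P(p²D) and P(D), and P(D) = S -
p^k A(b/p). -/
theorem skCoeffExt_recursion (hk : Odd k) (hp : p.Prime) (hp2 : p ≠ 2) (hpN : ¬ p ∣ N)
    (hc : HasHeckeEigenvalue k p c a) (b : ℤ × ℤ × ℤ) :
    skCoeffExt k N c ((p : ℤ) • (p : ℤ) • b)
      = ((p : ℂ) ^ k + a) * skCoeffExt k N c ((p : ℤ) • b)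
        - (p : ℂ) ^ k * ((p : ℂ) ^ (k - 1) + a) * skCoeffExt k N c b
        + (p : ℂ) ^ (3 * k - 1) * divCoeff p (skCoeffExt k N c) b := by
  have hp0 : (0 : ℤ) < p := by exact_mod_cast hp.pos
  have hk1 : 1 ≤ k := hk.pos
  by_cases h : TriplePosDef b
  swap
  · have h1 := mt (triplePosDef_smul hp0 b).1 h
    rw [skCoeffExt_of_not b h, skCoeffExt_of_not _ h1,
      skCoeffExt_of_not _ (mt (triplePosDef_smul hp0 _).1 h1)]
    have : divCoeff p (skCoeffExt k N c) b = 0 := by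
      by_cases hd : (p : ℤ) ∣ b.1 ∧ (p : ℤ) ∣ b.2.1 ∧ (p : ℤ) ∣ b.2.2
      · obtain ⟨n, r, m⟩ := b
        obtain ⟨⟨n, rfl⟩, ⟨r, rfl⟩, ⟨m, rfl⟩⟩ := hd
        exact (divCoeff_smul hp.pos _ (n, r, m)).trans
          (skCoeffExt_of_not _ (mt (triplePosDef_smul hp0 _).2 h))
      · exact divCoeff_of_not _ hd
    rw [this]; ring
  have hg := tripleContent_ne_zero h
  have h1 := (triplePosDef_smul hp0 b).2 h
  have hH : primeToSum k N p c (p ^ 2 * (p ^ 2 * (tripleDisc b).toNat)) (tripleContent b)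
      + (p : ℂ) ^ (2 * k - 1) * primeToSum k N p c (tripleDisc b).toNat (tripleContent b)
      = a * primeToSum k N p c (p ^ 2 * (tripleDisc b).toNat) (tripleContent b) := by
    refine primeToSum_hecke hp hp2 (fun d hd ↦ ?_) fun d hd ↦ ?_
    · obtain ⟨b', -, -, e, -⟩ := dvd_tripleContent h hd
      exact ⟨_, e⟩
    · obtain ⟨b', -, h', -, e⟩ := dvd_tripleContent h hd
      rw [e, ← toNat_tripleDisc_smul]
      exact hc _ (isPlusIndex_tripleDisc hk ((triplePosDef_smul hp0 b').2 h').2.le)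
  have hdiv : divisorSum k N c (tripleDisc b).toNat (tripleContent b)
      = primeToSum k N p c (tripleDisc b).toNat (tripleContent b)
        + (p : ℂ) ^ k * divCoeff p (skCoeffExt k N c) b := by
    by_cases hd : p ∣ tripleContent b
    · obtain ⟨b', rfl, h', -, -⟩ := dvd_tripleContent h hd
      rw [divCoeff_smul hp.pos, skCoeffExt_eq b' h', tripleContent_smul, toNat_tripleDisc_smul,
        divisorSum_mul hp hpN (tripleContent_ne_zero h'),
        primeToSum_mul hp (tripleContent_ne_zero h')]
    · rw [divCoeff_of_not, mul_zero, add_zero, primeToSum_eq_divisorSum hd]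
      rintro ⟨d1, d2, d3⟩
      exact hd (Nat.dvd_gcd (Int.natCast_dvd.1 d1)
        (Nat.dvd_gcd (Int.natCast_dvd.1 d2) (Int.natCast_dvd.1 d3)))
  rw [skCoeffExt_eq _ ((triplePosDef_smul hp0 _).2 h1), skCoeffExt_eq _ h1, skCoeffExt_eq b h]
  simp only [toNat_tripleDisc_smul, tripleContent_smul]
  rw [divisorSum_mul hp hpN (mul_ne_zero hp.ne_zero hg), divisorSum_mul hp hpN hg,
    primeToSum_mul hp hg]
  have e1 : (p : ℂ) ^ k * (p : ℂ) ^ (k - 1) = (p : ℂ) ^ (2 * k - 1) := by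
    rw [← pow_add]; congr 1; omega
  have e2 : (p : ℂ) ^ (3 * k - 1) = (p : ℂ) ^ (2 * k - 1) * (p : ℂ) ^ k := by
    rw [← pow_add]; congr 1; omega
  rw [e2]
  linear_combination hH + (p : ℂ) ^ (2 * k - 1) * hdiv
    + divisorSum k N c (tripleDisc b).toNat (tripleContent b) * e1

end SaitoKurokawa

end

theorem corollary4p5 (N k p : ℕ) (hN : Odd N) (hNsq : Squarefree N) (hk : Odd k)
    (hp : p.Prime) (hp2 : p ≠ 2) (hpN : ¬ p ∣ N)
    (f : CuspFormGamma0 N (2 * (k : ℤ))) (hf : IsNormalisedNewform N (2 * (k : ℤ)) f)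
    (h : UpperHalfPlane → ℂ) (hh : IsKohnenNewform k N h) (hh0 : h ≠ 0)
    (hfh : InShimuraShintani k N f h) :
    (∀ Z : SiegelUpperHalfSpace,
      Summable fun B : HalfIntegralPosDef ↦ skCoeff k N (qCoeff h) B * qMonomial B Z) ∧
    opUU p hp.pos (pullback (siegelU p hp.pos (skLift k N h)))
        - (p : ℂ) ^ (k - 1) • pullback (siegelU p hp.pos (skLift k N h)) =
      ((p : ℂ) ^ k - (p : ℂ) ^ (k - 1) + qCoeff f p) •
          opUU p hp.pos (pullback (skLift k N h))
        - ((p : ℂ) ^ k * ((p : ℂ) ^ (k - 1) + qCoeff f p)) • pullback (skLift k N h)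
        + (p : ℂ) ^ (3 * k - 1) • opVV p hp.pos (pullback (skLift k N h)) := by
  obtain ⟨C, hC, hb⟩ := hh.plusForm.cuspForm.exists_norm_qCoeff_le hN.pos.ne'
  have hs := summable_skCoeff_mul_qMonomial (k := k) (N := N) hC hb
  refine ⟨hs, ?_⟩
  have hp0 : (p : ℤ) ≠ 0 := by exact_mod_cast hp.ne_zero
  have hc : HasHeckeEigenvalue k p (qCoeff h) (qCoeff f p) := hfh p hp hpN
  have hF := hasSiegelExpansion_skLift hs
  set A := skCoeffExt k N (qCoeff h)
  have hUF := (hF.siegelU hp.pos).pullback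
  have hVV := hF.pullback.opVV hp.pos (g' := divCoeff p A) (fun b ↦ divCoeff_smul hp.pos A b)
    fun b hb ↦ divCoeff_of_not A hb
  -- The U×U term of the right side is moved to the left, so that every coefficient with p ∤ r
  -- cancels and r can be relabelled as pr.
  have hL := (hUF.opUU hp.pos).sub
    ((hF.pullback.opUU hp.pos).smul ((p : ℂ) ^ k - (p : ℂ) ^ (k - 1) + qCoeff f p))
  have hL' := hL.mul_mid hp0 fun b hb ↦ sub_eq_zero.2
    (skCoeffExt_smul_of_not_dvd hk hp hp2 hpN hc (b := (p * b.1, b.2.1, p * b.2.2))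
      (dvd_mul_right _ _) hb)
  have hR := ((hUF.smul ((p : ℂ) ^ (k - 1))).sub (hF.pullback.smul
    ((p : ℂ) ^ k * ((p : ℂ) ^ (k - 1) + qCoeff f p)))).add (hVV.smul ((p : ℂ) ^ (3 * k - 1)))
  -- After relabelling, both sides have equal coefficients by the recursion: λ and p^k + a differ by
  -- p^(k-1), which accounts for the term p^(k-1)ϖ(UF).
  have key := hL'.unique (φ' := _) (by
    convert hR using 1
    funext b
    have := skCoeffExt_recursion hk hp hp2 hpN hc b
    change A ((p : ℤ) • (p : ℤ) • b) - _ * A ((p : ℤ) • b)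
      = (p : ℂ) ^ (k - 1) * A ((p : ℤ) • b) - _ * A b + _ * divCoeff p A b
    linear_combination this)
  rw [sub_eq_iff_eq_add] at key ⊢
  rw [key]
  abel
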